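/- Let $w$ be a complex number with $|w|\leq 1$, $\operatorname{Re} w>0$, $\operatorname{Im} w\geq 0$ and $|1-w^2|\leq 2|w|$. Then the series below converges and $$\begin{aligned}\sum_{n=0}^{\infty}\frac{(-1)^n}{(2n+1)^3\binom{2n}{n}}\left(\frac{1-w^2}{w}\right)^{2n+1}={}&-2\left[\operatorname{Li}_3\!\left(\tfrac{1+w}{2}\right)-\operatorname{Li}_3\!\left(\tfrac{1-w}{2}\right)-\operatorname{Li}_3\!\left(\tfrac{1+1/w}{2}\right)+\operatorname{Li}_3\!\left(\tfrac{1-1/w}{2}\right)\right]\\&+\left[\operatorname{Li}_2\!\left(\tfrac{1+w}{2}\right)-\operatorname{Li}_2\!\left(\tfrac{1-w}{2}\right)+\operatorname{Li}_2\!\left(\tfrac{1+1/w}{2}\right)-\operatorname{Li}_2\!\left(\tfrac{1-1/w}{2}\right)\right]\log w\\&+\pi i\,\log\!\left(\tfrac{1+w}{2}\right)\log\!\left(\tfrac{1+1/w}{2}\right).\end{aligned}$$ Here $\log$ is the principal logarithm, and $\operatorname{Li}_2,\operatorname{Li}_3$ denote the principal branches of the dilogarithm and trilogarithm: $\operatorname{Li}_s(z)=\sum_{n\ge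 1} z^n/n^s$ for $|z|\le 1$, continued analytically to $\mathbb{C}\setminus[1,\infty)$, with the value at a real point $x>1$ of the branch cut taken as the limit from the lower half-plane, $\operatorname{Li}_s(x)=\lim_{\varepsilon\to0^+}\operatorname{Li}_s(x-i\varepsilon)$. -/

import Mathlib

/-- The principal branch of the dilogarithm, `Li₂(z) = -∫₀¹ log(1 - t z) / t dt`.

It equals `∑_{n ≥ 1} zⁿ / n²` on the closed unit disc (`hasSum_dilog`) and is holomorphic on
`ℂ ∖ [1, ∞)` (`differentiableOn_dilog`). Because `Complex.log` has argument `π` on the negative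
axis, the value at a real `x > 1` on the cut is the limit from the lower half plane,
`Im Li₂(x) = -π log x`, which is the usual convention (it corresponds to
`Li₁(x) = -log(1 - x)` with the principal logarithm). -/
noncomputable def dilog (z : ℂ) : ℂ :=
  ∫ t in (0 : ℝ)..1, -Complex.log (1 - t * z) / t

/-- The principal branch of the trilogarithm, `Li₃(z) = ∫₀¹ Li₂(t z) / t dt`.

It equals `∑_{n ≥ 1} zⁿ / n³` on the closed unit disc (`hasSum_trilog`) and is holomorphic on
`ℂ ∖ [1, ∞)` (`differentiableOn_trilog`); on the cut it is again the limit from the lower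
half plane. -/
noncomputable def trilog (z : ℂ) : ℂ :=
  ∫ t in (0 : ℝ)..1, dilog (t * z) / t

/-- Integrating the power series of `Li_s` against `dt / t` gives that of `Li_{s+1}`. -/
theorem hasSum_polylog_step (F : ℂ → ℂ) (s : ℕ) (hs : 1 ≤ s)
    (hF : ∀ z : ℂ, ‖z‖ < 1 → HasSum (fun n : ℕ => z ^ (n + 1) / ((n : ℂ) + 1) ^ s) (F z))
    (z : ℂ) (hz : ‖z‖ ≤ 1) :
    HasSum (fun n : ℕ => z ^ (n + 1) / ((n : ℂ) + 1) ^ (s + 1))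
      (∫ t in (0 : ℝ)..1, F (t * z) / t) := by
  have hval (n : ℕ) : ∫ t in (0 : ℝ)..1, (t : ℂ) ^ n * (z ^ (n + 1) / ((n : ℂ) + 1) ^ s) =
      z ^ (n + 1) / ((n : ℂ) + 1) ^ (s + 1) := by
    rw [intervalIntegral.integral_mul_const]
    have h : ∫ t in (0 : ℝ)..1, (t : ℂ) ^ n = 1 / ((n : ℂ) + 1) := by
      have h1 : ∫ t in (0 : ℝ)..1, ((t ^ n : ℝ) : ℂ) = ((∫ t in (0 : ℝ)..1, t ^ n : ℝ) : ℂ) :=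
        intervalIntegral.integral_ofReal
      simp only [Complex.ofReal_pow] at h1
      rw [h1, integral_pow]
      simp
    rw [h, pow_succ ((n : ℂ) + 1) s]
    have hn : (n : ℂ) + 1 ≠ 0 := Nat.cast_add_one_ne_zero n
    field_simp
  have hnorm (n : ℕ) : ∫ t in (0 : ℝ)..1, ‖(t : ℂ) ^ n * (z ^ (n + 1) / ((n : ℂ) + 1) ^ s)‖ =
      1 / ((n : ℝ) + 1) * (‖z‖ ^ (n + 1) / ((n : ℝ) + 1) ^ s) := by
    have h0 : ‖(n : ℂ) + 1‖ = (n : ℝ) + 1 := by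
      rw [← Nat.cast_add_one, Complex.norm_natCast]; simp
    have h1 : ∫ t in (0 : ℝ)..1, ‖(t : ℂ) ^ n * (z ^ (n + 1) / ((n : ℂ) + 1) ^ s)‖ =
        ∫ t in (0 : ℝ)..1, t ^ n * (‖z‖ ^ (n + 1) / ((n : ℝ) + 1) ^ s) := by
      apply intervalIntegral.integral_congr
      intro t ht
      rw [Set.uIcc_of_le zero_le_one] at ht
      simp only [norm_mul, norm_pow, norm_div, Complex.norm_real, Real.norm_of_nonneg ht.1, h0]
    rw [h1, intervalIntegral.integral_mul_const, integral_pow]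
    simp
  have key := MeasureTheory.hasSum_integral_of_summable_integral_norm
    (μ := MeasureTheory.volume.restrict (Set.Ioc (0 : ℝ) 1))
    (F := fun (n : ℕ) (t : ℝ) => (t : ℂ) ^ n * (z ^ (n + 1) / ((n : ℂ) + 1) ^ s)) ?_ ?_
  · simp only [← intervalIntegral.integral_of_le (zero_le_one' ℝ), hval] at key
    suffices hint : ∫ t in (0 : ℝ)..1, F (t * z) / t = ∫ t in (0 : ℝ)..1,
        ∑' n : ℕ, (t : ℂ) ^ n * (z ^ (n + 1) / ((n : ℂ) + 1) ^ s) by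
      rwa [hint]
    rw [intervalIntegral.integral_of_le zero_le_one, intervalIntegral.integral_of_le zero_le_one]
    apply MeasureTheory.integral_congr_ae
    have hne : ∀ᵐ t : ℝ ∂(MeasureTheory.volume.restrict (Set.Ioc (0 : ℝ) 1)), t ≠ 1 :=
      MeasureTheory.ae_restrict_of_ae (MeasureTheory.Measure.ae_ne MeasureTheory.volume 1)
    filter_upwards [hne, MeasureTheory.ae_restrict_mem measurableSet_Ioc] with t ht1 ht
    have htlt : t < 1 := lt_of_le_of_ne ht.2 ht1
    have hlt : ‖(t : ℂ) * z‖ < 1 := by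
      rw [norm_mul, Complex.norm_real, Real.norm_of_nonneg ht.1.le]
      exact (mul_le_of_le_one_right ht.1.le hz).trans_lt htlt
    have ht0 : (t : ℂ) ≠ 0 := by exact_mod_cast ht.1.ne'
    have hsum := (hF _ hlt).div_const (t : ℂ)
    rw [← hsum.tsum_eq]
    refine tsum_congr fun n => ?_
    rw [mul_pow, pow_succ (t : ℂ) n]
    field_simp
  · intro n
    have : Continuous (fun t : ℝ => (t : ℂ) ^ n * (z ^ (n + 1) / ((n : ℂ) + 1) ^ s)) := by
      fun_prop
    exact (this.intervalIntegrable 0 1).1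
  · simp only [← intervalIntegral.integral_of_le (zero_le_one' ℝ), hnorm]
    have hsum : Summable (fun n : ℕ => 1 / ((n : ℝ) + 1) ^ 2) := by
      have := (summable_nat_add_iff 1).2 (Real.summable_one_div_nat_pow.2 (one_lt_two))
      simpa using this
    refine Summable.of_nonneg_of_le (fun n => by positivity) (fun n => ?_) hsum
    have h1 : ‖z‖ ^ (n + 1) ≤ 1 := pow_le_one₀ (norm_nonneg _) hz
    have h2 : (n : ℝ) + 1 ≤ ((n : ℝ) + 1) ^ s :=
      le_self_pow₀ (by linarith [(Nat.cast_nonneg n : (0 : ℝ) ≤ n)]) (by omega)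
    rw [div_mul_div_comm, one_mul, pow_two]
    gcongr

/-- Integrating a holomorphic `F` with `F 0 = 0` against `dt / t` along rays keeps holomorphy on
the complex plane cut along `[1, ∞)`. -/
theorem differentiableOn_polylog_step (F : ℂ → ℂ) (h0 : F 0 = 0)
    (hF : DifferentiableOn ℂ F {z | 1 - z ∈ Complex.slitPlane}) :
    DifferentiableOn ℂ (fun z => ∫ t in (0 : ℝ)..1, F (t * z) / t)
      {z | 1 - z ∈ Complex.slitPlane} := by
  set D : Set ℂ := {z | 1 - z ∈ Complex.slitPlane} with hD
  have hDo : IsOpen D :=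
    Complex.isOpen_slitPlane.preimage (by fun_prop : Continuous fun z : ℂ => 1 - z)
  have hD0 : (0 : ℂ) ∈ D := by simp [hD]
  have hstar : ∀ z ∈ D, ∀ t : ℝ, t ∈ Set.Icc (0 : ℝ) 1 → (t : ℂ) * z ∈ D := by
    intro z hz t ht
    have := StarConvex.add_smul_mem Complex.starConvex_one_slitPlane
      (y := -z) (by simpa [hD, sub_eq_add_neg] using hz) ht.1 ht.2
    simpa [hD, sub_eq_add_neg] using this
  set H : ℂ → ℂ := dslope F 0 with hH
  have hHd : DifferentiableOn ℂ H D :=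
    (Complex.differentiableOn_dslope (hDo.mem_nhds hD0)).2 hF
  have hHd' : ContinuousOn (deriv H) D := (hHd.deriv hDo).continuousOn
  have hFH : ∀ z : ℂ, F z = z * H z := by
    intro z
    have := sub_smul_dslope F 0 z
    simpa [h0] using this.symm
  have heq : (fun z => ∫ t in (0 : ℝ)..1, F (t * z) / t) =
      fun z => z * ∫ t in (0 : ℝ)..1, H (t * z) := by
    funext z
    rw [← intervalIntegral.integral_const_mul]
    apply intervalIntegral.integral_congr_ae
    refine Filter.Eventually.of_forall fun t ht => ?_
    rw [Set.uIoc_of_le zero_le_one] at ht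
    have : (t : ℂ) ≠ 0 := by exact_mod_cast ht.1.ne'
    rw [hFH]
    field_simp
  rw [heq]
  refine differentiableOn_id.mul fun z hz => DifferentiableAt.differentiableWithinAt ?_
  obtain ⟨r, hr, hball⟩ := Metric.nhds_basis_closedBall.mem_iff.1 (hDo.mem_nhds hz)
  let K : Set ℂ := (fun p : ℝ × ℂ => (p.1 : ℂ) * p.2) '' (Set.Icc (0 : ℝ) 1 ×ˢ Metric.closedBall z r)
  have hK : IsCompact K := (isCompact_Icc.prod (isCompact_closedBall z r)).image (by fun_prop)
  have hKD : K ⊆ D := by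
    rintro _ ⟨⟨t, y⟩, ⟨ht, hy⟩, rfl⟩
    exact hstar y (hball hy) t ht
  obtain ⟨C, hC⟩ := hK.exists_bound_of_continuousOn (hHd'.mono hKD)
  have hcont (G : ℂ → ℂ) (hG : ContinuousOn G D) (y : ℂ) (hy : y ∈ D) :
      ContinuousOn (fun t : ℝ => G (t * y)) (Set.uIcc 0 1) := by
    rw [Set.uIcc_of_le zero_le_one]
    exact hG.comp (by fun_prop) fun t ht => hstar y hy t ht
  have hmeas (G : ℂ → ℂ) (hG : ContinuousOn G D) (y : ℂ) (hy : y ∈ D) :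
      MeasureTheory.AEStronglyMeasurable (fun t : ℝ => G (t * y))
        (MeasureTheory.volume.restrict (Set.uIoc 0 1)) :=
    ((hcont G hG y hy).intervalIntegrable.def').aestronglyMeasurable
  refine (intervalIntegral.hasDerivAt_integral_of_dominated_loc_of_deriv_le
    (F := fun y (t : ℝ) => H (t * y)) (F' := fun y (t : ℝ) => (t : ℂ) * deriv H (t * y))
    (bound := fun _ => C) (Metric.closedBall_mem_nhds z hr) ?_ ?_ ?_ ?_ ?_ ?_).2.differentiableAt
  · filter_upwards [hDo.mem_nhds hz] with y hy using hmeas H hHd.continuousOn y hy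
  · exact (hcont H hHd.continuousOn z hz).intervalIntegrable
  · exact (by fun_prop : Continuous fun t : ℝ => (t : ℂ)).aestronglyMeasurable.mul
      (hmeas _ hHd' z hz)
  · refine Filter.Eventually.of_forall fun t ht y hy => ?_
    rw [Set.uIoc_of_le zero_le_one] at ht
    have h1 := hC _ ⟨(t, y), ⟨⟨ht.1.le, ht.2⟩, hy⟩, rfl⟩
    have h2 : ‖(t : ℂ)‖ ≤ 1 := by simpa [abs_of_pos ht.1] using ht.2
    rw [norm_mul]
    exact (mul_le_of_le_one_left (norm_nonneg _) h2).trans h1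
  · exact intervalIntegrable_const
  · refine Filter.Eventually.of_forall fun t ht y hy => ?_
    rw [Set.uIoc_of_le zero_le_one] at ht
    have h1 : HasDerivAt H (deriv H (t * y)) (t * y) :=
      (hHd.differentiableAt (hDo.mem_nhds (hstar y (hball hy) t ⟨ht.1.le, ht.2⟩))).hasDerivAt
    have h2 : HasDerivAt (fun y : ℂ => (t : ℂ) * y) t y := by
      simpa using (hasDerivAt_id y).const_mul (t : ℂ)
    have h3 := h1.comp y h2
    rwa [mul_comm] at h3

theorem hasSum_dilog (z : ℂ) (hz : ‖z‖ ≤ 1) :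
    HasSum (fun n : ℕ => z ^ (n + 1) / ((n : ℂ) + 1) ^ 2) (dilog z) := by
  refine hasSum_polylog_step (fun z => -Complex.log (1 - z)) 1 le_rfl (fun z hz => ?_) z hz
  have := (hasSum_nat_add_iff' 1).2 (Complex.hasSum_taylorSeries_neg_log hz)
  simpa using this

theorem hasSum_trilog (z : ℂ) (hz : ‖z‖ ≤ 1) :
    HasSum (fun n : ℕ => z ^ (n + 1) / ((n : ℂ) + 1) ^ 3) (trilog z) :=
  hasSum_polylog_step dilog 2 one_le_two (fun z hz => hasSum_dilog z hz.le) z hz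

theorem differentiableOn_dilog : DifferentiableOn ℂ dilog {z | 1 - z ∈ Complex.slitPlane} := by
  refine differentiableOn_polylog_step (fun z => -Complex.log (1 - z)) (by simp) ?_
  have h : DifferentiableOn ℂ (fun z : ℂ => 1 - z) {z | 1 - z ∈ Complex.slitPlane} := by fun_prop
  exact (h.clog fun z hz => hz).neg

theorem differentiableOn_trilog : DifferentiableOn ℂ trilog {z | 1 - z ∈ Complex.slitPlane} :=
  differentiableOn_polylog_step dilog (by simp [dilog]) differentiableOn_dilog

open Set Filter Topology MeasureTheory

/-! Write `S_k(y) = ∑ (-1)^n y^(2n+1) / ((2n+1)^k C(2n,n))`, so that `y S_{k+1}' = S_k` for `|y| <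
2`. The ratio of consecutive central binomial coefficients gives the differential equation `(y² + 4)
S_1' + y S_1 = 4`. Under `y = (1 - w²)/w = -2 sinh u`, `w = exp u`, it solves to `S_1 · cosh u =
-2u`. Hence `dS_2 = 4 log w / (1 - w²) dw` and `dS_3 = -(1 + w²)/(1 - w²) · S_2 du`, and two
integrations from `w = 1`, where everything vanishes, give the identity.

The integration runs along `w = exp (t l)`, `l = log w`, `0 ≤ t ≤ 1`. Since `|sinh (x + iy)|² =
sinh² x + sin² y`, `|y|` stays below `2` for `t < 1` (`norm_sinh_real_mul_lt`); the endpoint is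
reached by continuity of `S_3` on the closed disc. The primitive for `S_2` is `dilogPrimitive`, that
for `S_3` is `trilogPrimitive`. The derivative of the latter has the required form only modulo
`dilogReflection`, which vanishes by Euler's reflection formula.

The delicate point is the branch cut: `(1 + 1/w)/2` stays in the closed lower half plane, and for
real `w < 1` it moves along the cut itself. There `dilog` and `trilog` are continuous from below
(`continuousOn_dilog`, `continuousOn_trilog`), and the derivative formulas extend to the boundary
(`hasDerivAt_polylog_step_comp`). -/

/-! ### Derivatives of polylogarithms on the cut plane and along its boundary -/

theorem isOpen_cutPlane : IsOpen {z : ℂ | 1 - z ∈ Complex.slitPlane} :=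
  Complex.isOpen_slitPlane.preimage (by fun_prop : Continuous fun z : ℂ => 1 - z)

theorem real_mul_mem_cutPlane {z : ℂ} (hz : 1 - z ∈ Complex.slitPlane) {t : ℝ}
    (ht : t ∈ Icc (0 : ℝ) 1) : 1 - (t : ℂ) * z ∈ Complex.slitPlane := by
  have := StarConvex.add_smul_mem Complex.starConvex_one_slitPlane
    (y := -z) (by simpa [sub_eq_add_neg] using hz) ht.1 ht.2
  simpa [sub_eq_add_neg] using this

theorem mul_dslope_zero {F : ℂ → ℂ} (h0 : F 0 = 0) (z : ℂ) : z * dslope F 0 z = F z := by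
  have := sub_smul_dslope F 0 z
  simpa [h0] using this

theorem differentiableOn_dslope_cutPlane {F : ℂ → ℂ}
    (hF : DifferentiableOn ℂ F {z | 1 - z ∈ Complex.slitPlane}) :
    DifferentiableOn ℂ (dslope F 0) {z | 1 - z ∈ Complex.slitPlane} :=
  (Complex.differentiableOn_dslope (isOpen_cutPlane.mem_nhds (by simp))).2 hF

/-- Rescaling the integral that defines the next polylogarithm. -/
theorem polylog_step_real_mul {F : ℂ → ℂ} (h0 : F 0 = 0) (r : ℝ) (z : ℂ) :
    ∫ t in (0 : ℝ)..1, F (t * (r * z)) / t = ∫ s in (0 : ℝ)..r, F (s * z) / s := by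
  rcases eq_or_ne r 0 with rfl | hr
  · simp [h0]
  · have h := intervalIntegral.smul_integral_comp_mul_left
      (f := fun s : ℝ => F (s * z) / s) (a := 0) (b := 1) r
    simp only [mul_zero, mul_one] at h
    rw [← h, ← intervalIntegral.integral_smul]
    refine intervalIntegral.integral_congr fun t _ => ?_
    have hr' : (r : ℂ) ≠ 0 := by exact_mod_cast hr
    simp only [Complex.ofReal_mul, Complex.real_smul]
    rw [show (t : ℂ) * (r * z) = r * t * z by ring]
    rcases eq_or_ne t 0 with rfl | ht
    · simp
    · have ht' : (t : ℂ) ≠ 0 := by exact_mod_cast ht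
      field_simp

/-- The derivative of the next polylogarithm on the plane cut along `[1, ∞)`. -/
theorem hasDerivAt_polylog_step {F : ℂ → ℂ} (h0 : F 0 = 0)
    (hF : DifferentiableOn ℂ F {z | 1 - z ∈ Complex.slitPlane})
    {z : ℂ} (hz : 1 - z ∈ Complex.slitPlane) (hz0 : z ≠ 0) :
    HasDerivAt (fun z => ∫ t in (0 : ℝ)..1, F (t * z) / t) (F z / z) z := by
  set P : ℂ → ℂ := fun z => ∫ t in (0 : ℝ)..1, F (t * z) / t with hP
  have hd : DifferentiableAt ℂ P z :=
    (differentiableOn_polylog_step F h0 hF).differentiableAt (isOpen_cutPlane.mem_nhds hz)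
  -- The function `r ↦ P (r z)` is differentiated at `r = 1` in two ways: the chain rule gives
  -- `P'(z) z`, the rescaled integral and the fundamental theorem of calculus give `F z`.
  have h1 : HasDerivAt (fun r : ℝ => P (r * z)) (deriv P z * z) 1 := by
    have hg : HasDerivAt (fun r : ℝ => (r : ℂ) * z) z 1 := by
      simpa using (Complex.ofRealCLM.hasDerivAt (x := 1)).mul_const z
    have := HasDerivAt.comp_of_eq (h₂ := P) (h := fun r : ℝ => (r : ℂ) * z) 1 hd.hasDerivAt hg (by simp)
    exact this
  have hdF := (differentiableOn_dslope_cutPlane hF).continuousOn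
  have hev : ∀ᶠ s : ℝ in 𝓝 1, 1 - (s : ℂ) * z ∈ Complex.slitPlane :=
    (by fun_prop : Continuous fun s : ℝ => 1 - (s : ℂ) * z).continuousAt.eventually
      (Complex.isOpen_slitPlane.mem_nhds (by simpa using hz))
  have h2 : HasDerivAt (fun r : ℝ => P (r * z)) (F z) 1 := by
    simp only [hP, polylog_step_real_mul h0]
    have h3 : (fun s : ℝ => F (s * z) / s) =ᵐ[volume] fun s : ℝ => z * dslope F 0 (s * z) := by
      filter_upwards [Measure.ae_ne volume (0 : ℝ)] with s hs
      have hs' : (s : ℂ) ≠ 0 := by exact_mod_cast hs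
      rw [← mul_dslope_zero h0]
      field_simp
    have h4 : (fun r : ℝ => ∫ s in (0 : ℝ)..r, F (s * z) / s) =
        fun r : ℝ => ∫ s in (0 : ℝ)..r, z * dslope F 0 (s * z) := by
      funext r
      exact intervalIntegral.integral_congr_ae (h3.mono fun s hs _ => hs)
    rw [h4]
    have hc : ∀ s : ℝ, 1 - (s : ℂ) * z ∈ Complex.slitPlane →
        ContinuousAt (fun s : ℝ => z * dslope F 0 (s * z)) s := by
      intro s hs
      refine continuousAt_const.mul ?_
      exact ContinuousAt.comp (f := fun s : ℝ => (s : ℂ) * z)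
        (hdF.continuousAt (isOpen_cutPlane.mem_nhds hs)) (by fun_prop)
    have h5 := intervalIntegral.integral_hasDerivAt_right
      (f := fun s : ℝ => z * dslope F 0 (s * z)) (a := 0) (b := 1) ?_ ?_ ?_
    · simpa [mul_dslope_zero h0] using h5
    · refine ContinuousOn.intervalIntegrable fun s hs => (hc s ?_).continuousWithinAt
      rw [uIcc_of_le zero_le_one] at hs
      exact real_mul_mem_cutPlane hz hs
    · have ho : IsOpen {s : ℝ | 1 - (s : ℂ) * z ∈ Complex.slitPlane} :=
        Complex.isOpen_slitPlane.preimage (by fun_prop : Continuous fun s : ℝ => 1 - (s : ℂ) * z)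
      exact (ContinuousOn.stronglyMeasurableAtFilter ho
        (fun s hs => (hc s hs).continuousWithinAt)) 1 hev.self_of_nhds
    · exact hc 1 hev.self_of_nhds
  have h3 := h1.unique h2
  have h6 := hd.hasDerivAt
  rwa [(eq_div_iff hz0).2 h3] at h6

/-- The derivative, along a curve in the closed lower half plane, of the next polylogarithm. -/
theorem hasDerivAt_polylog_step_comp {F : ℂ → ℂ} (h0 : F 0 = 0)
    (hF : DifferentiableOn ℂ F {z | 1 - z ∈ Complex.slitPlane})
    (hP : ContinuousOn (fun z => ∫ t in (0 : ℝ)..1, F (t * z) / t) {z : ℂ | z.im ≤ 0})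
    {γ : ℝ → ℂ} {γ' : ℂ} {s : ℝ} (hγ : HasDerivAt γ γ' s) (hγH : ∀ᶠ u in 𝓝 s, (γ u).im ≤ 0)
    (hγ0 : γ s ≠ 0) (hFc : ContinuousWithinAt F {z : ℂ | z.im ≤ 0} (γ s)) :
    HasDerivAt (fun u => ∫ t in (0 : ℝ)..1, F (t * γ u) / t) (F (γ s) / γ s * γ') s := by
  set P : ℂ → ℂ := fun z => ∫ t in (0 : ℝ)..1, F (t * z) / t with hPdef
  have hopen : IsOpen {z : ℂ | z.im < 0} := isOpen_lt Complex.continuous_im continuous_const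
  have hconv : Convex ℝ {z : ℂ | z.im < 0} := convex_halfSpace_im_lt 0
  have hcl : closure {z : ℂ | z.im < 0} = {z : ℂ | z.im ≤ 0} := by
    simp
  have hd : ∀ z : ℂ, z.im < 0 → HasDerivAt P (F z / z) z := by
    intro z hz
    refine hasDerivAt_polylog_step h0 hF (Or.inr ?_) ?_
    · simpa using hz.ne
    · rintro rfl; simp at hz
  -- The derivative `F z / z` has a limit at the boundary point, so `P` is differentiable there
  -- within the closed half plane. This extension principle is real, hence the restriction of
  -- scalars.
  have key : HasFDerivWithinAt P
      ((ContinuousLinearMap.toSpanSingleton ℂ (F (γ s) / γ s)).restrictScalars ℝ)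
      (closure {z : ℂ | z.im < 0}) (γ s) := by
    refine hasFDerivWithinAt_closure_of_tendsto_fderiv
      (fun z hz => ((hd z hz).differentiableAt.restrictScalars ℝ).differentiableWithinAt)
      hconv hopen ?_ ?_
    · intro y hy
      rw [hcl] at hy
      exact (hP y hy).mono fun z (hz : z.im < 0) => hz.le
    · have h1 : Tendsto (fun y => F y / y) (𝓝[{z : ℂ | z.im < 0}] (γ s)) (𝓝 (F (γ s) / γ s)) :=
        ((hFc.mono fun z (hz : z.im < 0) => hz.le).div continuousWithinAt_id hγ0)
      have h2 : Continuous fun c : ℂ =>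
          (ContinuousLinearMap.toSpanSingleton ℂ c).restrictScalars ℝ := by
        have : Continuous fun c : ℂ => ContinuousLinearMap.toSpanSingleton ℂ c :=
          (ContinuousLinearMap.toSpanSingletonLE ℂ ℂ ℂ).continuous_of_finiteDimensional
        exact (ContinuousLinearMap.continuous_restrictScalars ℝ).comp this
      refine ((h2.tendsto _).comp h1).congr' ?_
      filter_upwards [self_mem_nhdsWithin] with y hy
      exact (((hd y hy).hasFDerivAt.restrictScalars ℝ).fderiv).symm
  rw [hcl] at key
  have h := key.comp_hasDerivAt s hγ hγH
  refine HasDerivAt.congr_deriv h ?_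
  simp [mul_comm]

/-! ### Continuity of the dilogarithm and trilogarithm up to the cut -/

/-- Since `‖1 - sζ‖ ≥ |1 - s|`, the singularity at `s = 1` is at worst logarithmic, uniformly in the
direction `ζ`; for `|s| ≤ 1/2` the zero of the logarithm cancels the denominator. This is the
integrable majorant for `continuousOn_dilog`. -/
theorem norm_log_one_sub_mul_div_le {ζ : ℂ} (hζ : ‖ζ‖ = 1) {s R : ℝ} (hs : -(1 / 2) < s)
    (hsR : s ≤ R) (hs1 : s ≠ 1) (hR : 0 ≤ R) :
    ‖-Complex.log (1 - s * ζ) / s‖ ≤ 3 / 2 + 2 * (|Real.log (1 - s)| + Real.log (1 + R) + Real.pi) := by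
  have hlogR : 0 ≤ Real.log (1 + R) := Real.log_nonneg (by linarith)
  have hpi := Real.pi_pos
  have hns : ‖(s : ℂ) * ζ‖ = |s| := by simp [hζ]
  rw [norm_div, norm_neg, Complex.norm_real, Real.norm_eq_abs]
  rcases le_or_gt |s| (1 / 2) with h | h
  · have h1 := Complex.norm_log_one_add_half_le_self (z := -(s * ζ)) (by rw [norm_neg, hns]; exact h)
    rw [norm_neg, hns, ← sub_eq_add_neg] at h1
    have h2 : ‖Complex.log (1 - s * ζ)‖ / |s| ≤ 3 / 2 := by
      rcases eq_or_ne s 0 with rfl | h0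
      · simp; norm_num
      · rwa [div_le_iff₀ (abs_pos.2 h0)]
    have := abs_nonneg (Real.log (1 - s))
    linarith
  · have hs2 : 1 / 2 < s := by
      rcases abs_cases s with ⟨h1, _⟩ | ⟨h1, _⟩ <;> linarith
    rw [abs_of_pos (by linarith)]
    have hlow : |1 - s| ≤ ‖1 - s * ζ‖ := by
      have := abs_norm_sub_norm_le (1 : ℂ) (s * ζ)
      rwa [hns, norm_one, abs_of_pos (by linarith : 0 < s)] at this
    have hup : ‖1 - s * ζ‖ ≤ 1 + R := by
      have := norm_sub_le (1 : ℂ) (s * ζ)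
      rw [hns, norm_one, abs_of_pos (by linarith : 0 < s)] at this
      linarith
    have hpos : 0 < |1 - s| := abs_pos.2 (sub_ne_zero.2 hs1.symm)
    have h1 : Real.log |1 - s| ≤ Real.log ‖1 - s * ζ‖ := Real.log_le_log hpos hlow
    have h2 : Real.log ‖1 - s * ζ‖ ≤ Real.log (1 + R) :=
      Real.log_le_log (hpos.trans_le hlow) hup
    rw [Real.log_abs] at h1
    have h3 : |Real.log ‖1 - s * ζ‖| ≤ |Real.log (1 - s)| + Real.log (1 + R) := by
      have h5 := neg_abs_le (Real.log (1 - s))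
      have h6 := abs_nonneg (Real.log (1 - s))
      rw [abs_le]; constructor <;> linarith
    have h4 : ‖Complex.log (1 - s * ζ)‖ ≤ |Real.log (1 - s)| + Real.log (1 + R) + Real.pi := by
      refine (Complex.norm_le_abs_re_add_abs_im _).trans ?_
      rw [Complex.log_re, Complex.log_im]
      exact add_le_add h3 (Complex.abs_arg_le_pi _)
    rw [div_le_iff₀ (by linarith)]
    nlinarith [norm_nonneg (Complex.log (1 - s * ζ))]

/-- On the negative axis the principal argument is `π`, its limit from above. -/
theorem continuousWithinAt_log_upperHalfPlane {z : ℂ} (hz : z ≠ 0) :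
    ContinuousWithinAt Complex.log {z : ℂ | 0 ≤ z.im} z := by
  by_cases h : z ∈ Complex.slitPlane
  · exact (continuousAt_clog h).continuousWithinAt
  · rw [Complex.mem_slitPlane_iff, not_or, not_lt, not_not] at h
    refine Complex.continuousWithinAt_log_of_re_neg_of_im_zero (h.1.lt_of_ne fun h0 => hz ?_) h.2
    exact Complex.ext h0 h.2

/-- In polar form, `Li₂(z)` is the integral of `-log (1 - sζ) / s` over `0 ≤ s ≤ ‖z‖` with `ζ =
z/‖z‖`. The possible singularity then sits at the fixed point `s = 1` for every `z`, and dominated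
convergence applies. -/
theorem continuousOn_dilog : ContinuousOn dilog {z : ℂ | z.im ≤ 0} := by
  intro z₀ hz₀
  rcases eq_or_ne z₀ 0 with rfl | hne
  · exact (differentiableOn_dilog.continuousOn.continuousAt
      (isOpen_cutPlane.mem_nhds (by simp))).continuousWithinAt
  let X := {z : ℂ // z.im ≤ 0 ∧ z ≠ 0}
  let x₀ : X := ⟨z₀, hz₀, hne⟩
  let ζ : X → ℂ := fun x => (x : ℂ) / (‖(x : ℂ)‖ : ℂ)
  have hζ : ∀ x : X, ‖ζ x‖ = 1 := fun x => by simp [ζ, x.2.2]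
  have hζc : Continuous ζ := by
    refine Continuous.div (by fun_prop) (by fun_prop) fun x => ?_
    simpa using x.2.2
  have hζim : ∀ x : X, (ζ x).im ≤ 0 := fun x => by
    simp only [ζ, Complex.div_ofReal_im]
    exact div_nonpos_of_nonpos_of_nonneg x.2.1 (norm_nonneg _)
  set R : ℝ := ‖z₀‖ + 1 with hR
  have hR0 : 0 ≤ R := by positivity
  have hι : uIoc (-(1 / 2) : ℝ) R = Ioc (-(1 / 2)) R := uIoc_of_le (by linarith)
  -- The interval from `-1/2` to `‖z₀‖ + 1` has both endpoints of integration, `0` and `‖z₀‖`, in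
  -- its interior.
  have key := intervalIntegral.continuousAt_parametric_primitive_of_dominated (μ := volume)
    (F := fun (x : X) (s : ℝ) => -Complex.log (1 - s * ζ x) / s)
    (fun s => 3 / 2 + 2 * (|Real.log (1 - s)| + Real.log (1 + R) + Real.pi)) (-(1 / 2)) R
    (a₀ := 0) (b₀ := ‖z₀‖) (x₀ := x₀) ?_ ?_ ?_ ?_ ⟨by norm_num, by positivity⟩
    ⟨by linarith [norm_nonneg z₀], by simp [hR]⟩ (by simp)
  · have hX : ContinuousAt (fun x : X => dilog x) x₀ := by
      have h1 : (fun x : X => dilog x) = (fun p : X × ℝ =>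
          ∫ t in (0 : ℝ)..p.2, -Complex.log (1 - t * ζ p.1) / t) ∘ fun x : X => (x, ‖(x : ℂ)‖) := by
        funext x
        have h2 : (x : ℂ) = (‖(x : ℂ)‖ : ℝ) * ζ x := by
          have : (‖(x : ℂ)‖ : ℂ) ≠ 0 := by simpa using x.2.2
          simp only [ζ]; field_simp
        have h3 := polylog_step_real_mul (F := fun z => -Complex.log (1 - z)) (by simp)
          ‖(x : ℂ)‖ (ζ x)
        rw [← h2] at h3
        exact h3
      rw [h1]
      exact ContinuousAt.comp key (by fun_prop)
    have h2 : ContinuousWithinAt dilog {z : ℂ | z.im ≤ 0 ∧ z ≠ 0} z₀ :=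
      (continuousWithinAt_iff_continuousAt_domRestrict dilog (s := {z : ℂ | z.im ≤ 0 ∧ z ≠ 0})
        ⟨hz₀, hne⟩).2 hX
    refine h2.mono_of_mem_nhdsWithin ?_
    filter_upwards [self_mem_nhdsWithin, mem_nhdsWithin_of_mem_nhds (isOpen_ne.mem_nhds hne)]
      with z h1 h2 using ⟨h1, h2⟩
  · intro x
    exact (by fun_prop : Measurable fun s : ℝ => -Complex.log (1 - s * ζ x) / s).aestronglyMeasurable
  · refine Eventually.of_forall fun x => ?_
    rw [hι]
    filter_upwards [ae_restrict_mem measurableSet_Ioc,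
      ae_restrict_of_ae (Measure.ae_ne volume (1 : ℝ))] with s hs hs1
    exact norm_log_one_sub_mul_div_le (hζ x) hs.1 hs.2 hs1 hR0
  · have h1 : IntervalIntegrable (fun s : ℝ => Real.log (1 - s)) volume (-(1 / 2)) R := by
      have := (intervalIntegral.intervalIntegrable_log' (a := 1 - -(1 / 2)) (b := 1 - R)).comp_sub_left 1
      simpa using this
    exact intervalIntegrable_const.add
      (((h1.abs.add intervalIntegrable_const).add intervalIntegrable_const).const_mul 2)
  · rw [hι]
    filter_upwards [ae_restrict_mem measurableSet_Ioc,
      ae_restrict_of_ae (Measure.ae_ne volume (1 : ℝ))] with s hs hs1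
    refine ContinuousAt.div_const (ContinuousAt.neg ?_) _
    have hg : Continuous fun x : X => 1 - (s : ℂ) * ζ x := by fun_prop
    rcases le_or_gt s 0 with h0 | h0
    · refine hg.continuousAt.clog (Or.inl ?_)
      have h1 : |((s : ℂ) * ζ x₀).re| ≤ |s| := by
        refine (Complex.abs_re_le_norm _).trans ?_
        simp [hζ]
      rw [abs_of_nonpos h0] at h1
      have := (abs_le.1 h1).2
      have := hs.1
      simp only [Complex.sub_re, Complex.one_re]
      linarith
    · have hne0 : 1 - (s : ℂ) * ζ x₀ ≠ 0 := by
        intro h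
        have h1 : ‖(s : ℂ) * ζ x₀‖ = 1 := by rw [← sub_eq_zero.1 h]; simp
        simp [hζ, abs_of_pos h0] at h1
        exact hs1 h1
      refine (continuousWithinAt_log_upperHalfPlane hne0).tendsto.comp
        (tendsto_nhdsWithin_iff.2 ⟨hg.continuousAt, Eventually.of_forall fun x => ?_⟩)
      simp
      exact mul_nonpos_of_nonneg_of_nonpos h0.le (hζim x)

theorem continuousOn_dslope_dilog : ContinuousOn (dslope dilog 0) {z : ℂ | z.im ≤ 0} := by
  intro z hz
  rcases eq_or_ne z 0 with rfl | h0
  · exact ((differentiableOn_dslope_cutPlane differentiableOn_dilog).continuousOn.continuousAt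
      (isOpen_cutPlane.mem_nhds (by simp))).continuousWithinAt
  · exact (continuousWithinAt_dslope_of_ne h0).2 (continuousOn_dilog z hz)

theorem dilog_zero : dilog 0 = 0 := by simp [dilog]

/-- Replacing `dilog` by its slope at `0` removes the division by `t`; the integrand is then
continuous and bounded on compact half discs. -/
theorem continuousOn_trilog : ContinuousOn trilog {z : ℂ | z.im ≤ 0} := by
  have hmem : ∀ t : ℝ, 0 ≤ t → ∀ z : ℂ, z.im ≤ 0 → ((t : ℂ) * z).im ≤ 0 := fun t ht z hz => by
    simpa using mul_nonpos_of_nonneg_of_nonpos ht hz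
  have heq : ∀ z, trilog z = z * ∫ t in (0 : ℝ)..1, dslope dilog 0 (t * z) := by
    intro z
    rw [← intervalIntegral.integral_const_mul]
    refine intervalIntegral.integral_congr_ae (Eventually.of_forall fun t ht => ?_)
    rw [uIoc_of_le zero_le_one] at ht
    have : (t : ℂ) ≠ 0 := by exact_mod_cast ht.1.ne'
    rw [← mul_dslope_zero dilog_zero]
    field_simp
  rw [show trilog = _ from funext heq]
  refine continuousOn_id.mul fun z₀ hz₀ => ?_
  have hK : IsCompact ({z : ℂ | z.im ≤ 0} ∩ Metric.closedBall 0 (‖z₀‖ + 1)) :=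
    (isCompact_closedBall _ _).inter_left (isClosed_le Complex.continuous_im continuous_const)
  obtain ⟨C, hC⟩ := hK.exists_bound_of_continuousOn (continuousOn_dslope_dilog.mono inter_subset_left)
  refine intervalIntegral.continuousWithinAt_of_dominated_interval (bound := fun _ => C) ?_ ?_
    intervalIntegrable_const ?_
  · filter_upwards [self_mem_nhdsWithin] with z hz
    have : ContinuousOn (fun t : ℝ => dslope dilog 0 (t * z)) (uIcc 0 1) := by
      refine continuousOn_dslope_dilog.comp (by fun_prop) fun t ht => ?_
      rw [uIcc_of_le zero_le_one] at ht
      exact hmem t ht.1 z hz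
    exact this.intervalIntegrable.def'.aestronglyMeasurable
  · filter_upwards [self_mem_nhdsWithin, mem_nhdsWithin_of_mem_nhds
      (Metric.closedBall_mem_nhds z₀ one_pos)] with z hz hzb
    refine Eventually.of_forall fun t ht => hC _ ⟨?_, ?_⟩
    · rw [uIoc_of_le zero_le_one] at ht
      exact hmem t ht.1.le z hz
    · rw [uIoc_of_le zero_le_one] at ht
      rw [mem_closedBall_zero_iff, norm_mul, Complex.norm_real, Real.norm_of_nonneg ht.1.le]
      have h1 : ‖z‖ ≤ ‖z₀‖ + 1 := by
        have := norm_le_norm_add_norm_sub' z z₀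
        rw [mem_closedBall_iff_norm] at hzb
        linarith
      exact (mul_le_of_le_one_left (norm_nonneg z) ht.2).trans h1
  · refine Eventually.of_forall fun t ht => ?_
    rw [uIoc_of_le zero_le_one] at ht
    exact (continuousOn_dslope_dilog _ (hmem t ht.1.le z₀ hz₀)).comp
      (f := fun z : ℂ => (t : ℂ) * z)
      (by fun_prop : Continuous fun z : ℂ => (t : ℂ) * z).continuousWithinAt
      fun z hz => hmem t ht.1.le z hz

theorem hasDerivAt_dilog {z : ℂ} (hz : 1 - z ∈ Complex.slitPlane) (hz0 : z ≠ 0) :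
    HasDerivAt dilog (-Complex.log (1 - z) / z) z := by
  refine hasDerivAt_polylog_step (F := fun z => -Complex.log (1 - z)) (by simp) ?_ hz hz0
  have h : DifferentiableOn ℂ (fun z : ℂ => 1 - z) {z | 1 - z ∈ Complex.slitPlane} := by fun_prop
  exact (h.clog fun z hz => hz).neg

theorem hasDerivAt_trilog {z : ℂ} (hz : 1 - z ∈ Complex.slitPlane) (hz0 : z ≠ 0) :
    HasDerivAt trilog (dilog z / z) z :=
  hasDerivAt_polylog_step dilog_zero differentiableOn_dilog hz hz0

/-- The derivative of the dilogarithm along a curve in the closed lower half plane, which may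
run along the branch cut. -/
theorem hasDerivAt_dilog_comp {γ : ℝ → ℂ} {γ' : ℂ} {s : ℝ} (hγ : HasDerivAt γ γ' s)
    (hγH : ∀ᶠ u in 𝓝 s, (γ u).im ≤ 0) (hγ0 : γ s ≠ 0) (hγ1 : γ s ≠ 1) :
    HasDerivAt (fun u => dilog (γ u)) (-Complex.log (1 - γ s) / γ s * γ') s := by
  refine hasDerivAt_polylog_step_comp (F := fun z => -Complex.log (1 - z)) (by simp) ?_
    continuousOn_dilog hγ hγH hγ0 ?_
  · have h : DifferentiableOn ℂ (fun z : ℂ => 1 - z) {z | 1 - z ∈ Complex.slitPlane} := by fun_prop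
    exact (h.clog fun z hz => hz).neg
  · refine ContinuousWithinAt.neg ?_
    exact (continuousWithinAt_log_upperHalfPlane (sub_ne_zero.2 hγ1.symm)).comp
      (f := fun z : ℂ => 1 - z)
      (by fun_prop : Continuous fun z : ℂ => 1 - z).continuousWithinAt fun z hz => by simpa using hz

theorem hasDerivAt_trilog_comp {γ : ℝ → ℂ} {γ' : ℂ} {s : ℝ} (hγ : HasDerivAt γ γ' s)
    (hγH : ∀ᶠ u in 𝓝 s, (γ u).im ≤ 0) (hγ0 : γ s ≠ 0) :
    HasDerivAt (fun u => trilog (γ u)) (dilog (γ s) / γ s * γ') s :=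
  hasDerivAt_polylog_step_comp dilog_zero differentiableOn_dilog continuousOn_trilog hγ hγH hγ0
    (continuousOn_dilog _ hγH.self_of_nhds)

/-! ### Continuity on the closed unit disc, and uniqueness of primitives -/

theorem summable_one_div_add_one_sq : Summable fun n : ℕ => 1 / ((n : ℝ) + 1) ^ 2 := by
  have := (summable_nat_add_iff 1).2 (Real.summable_one_div_nat_pow.2 one_lt_two)
  simpa using this

theorem continuousOn_tsum_pow_div (s : ℕ) (hs : 2 ≤ s) :
    ContinuousOn (fun z : ℂ => ∑' n : ℕ, z ^ (n + 1) / ((n : ℂ) + 1) ^ s)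
      (Metric.closedBall 0 1) := by
  refine continuousOn_tsum (fun n => by fun_prop) summable_one_div_add_one_sq fun n z hz => ?_
  rw [mem_closedBall_zero_iff] at hz
  have h0 : ‖(n : ℂ) + 1‖ = (n : ℝ) + 1 := by
    rw [← Nat.cast_add_one, Complex.norm_natCast]; simp
  rw [norm_div, norm_pow, norm_pow, h0]
  have h1 : (1 : ℝ) ≤ n + 1 := by linarith [(Nat.cast_nonneg n : (0 : ℝ) ≤ n)]
  exact div_le_div₀ zero_le_one (pow_le_one₀ (norm_nonneg _) hz) (by positivity)
    (pow_le_pow_right₀ h1 hs)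

/-- The argument `(1 + w)/2` tends to `1`, the tip of the cut, through the upper half plane, where
continuity from below says nothing. -/
theorem continuousOn_dilog_closedBall : ContinuousOn dilog (Metric.closedBall 0 1) :=
  (continuousOn_tsum_pow_div 2 le_rfl).congr fun z hz =>
    (hasSum_dilog z (mem_closedBall_zero_iff.1 hz)).tsum_eq.symm

theorem continuousOn_trilog_closedBall : ContinuousOn trilog (Metric.closedBall 0 1) :=
  (continuousOn_tsum_pow_div 3 (by norm_num)).congr fun z hz =>
    (hasSum_trilog z (mem_closedBall_zero_iff.1 hz)).tsum_eq.symm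

/-- Two functions with equal derivatives that agree at one end of an interval agree at the other. -/
theorem eq_of_hasDerivAt_eq {f g f' : ℝ → ℂ} {a b : ℝ} (hab : a ≤ b)
    (hf : ContinuousOn f (Icc a b)) (hg : ContinuousOn g (Icc a b))
    (hf' : ∀ x ∈ Ioo a b, HasDerivAt f (f' x) x) (hg' : ∀ x ∈ Ioo a b, HasDerivAt g (f' x) x)
    (h : f a = g a) : f b = g b := by
  have := intervalIntegral.integral_eq_sub_of_hasDerivAt_of_le (f := f - g) (f' := fun _ => 0) hab
    (hf.sub hg) (fun x hx => by simpa using (hf' x hx).sub (hg' x hx)) intervalIntegrable_const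
  simp [h] at this
  exact (sub_eq_zero.1 this.symm)

/-! ### The central binomial series and its differential equation -/

noncomputable def centralCoeff (k n : ℕ) : ℂ :=
  (-1 : ℂ) ^ n / ((2 * (n : ℂ) + 1) ^ k * ((2 * n).choose n : ℂ))

noncomputable def centralSeries (k : ℕ) (y : ℂ) : ℂ :=
  ∑' n : ℕ, centralCoeff k n * y ^ (2 * n + 1)

theorem two_mul_natCast_add_one_ne_zero (n : ℕ) : (2 * (n : ℂ) + 1) ≠ 0 := by
  exact_mod_cast (Nat.succ_ne_zero (2 * n))

theorem choose_two_mul_ne_zero (n : ℕ) : ((2 * n).choose n : ℂ) ≠ 0 := by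
  exact_mod_cast (Nat.choose_pos (by omega)).ne'

theorem norm_two_mul_natCast_add_one (n : ℕ) : ‖(2 * (n : ℂ) + 1)‖ = 2 * (n : ℝ) + 1 := by
  have : (2 * (n : ℂ) + 1) = ((2 * n + 1 : ℕ) : ℂ) := by push_cast; ring
  rw [this, Complex.norm_natCast]; push_cast; ring

/-- From `4^n ≤ (2n+1) C(2n,n)`; this yields convergence for `|y| < 2`. -/
theorem norm_centralCoeff_le (k n : ℕ) :
    ‖centralCoeff k n‖ ≤ (2 * (n : ℝ) + 1) / ((2 * (n : ℝ) + 1) ^ k * 4 ^ n) := by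
  have h : (4 : ℝ) ^ n ≤ (2 * n + 1) * ((2 * n).choose n : ℝ) := by
    exact_mod_cast Nat.four_pow_le_two_mul_add_one_mul_central_binom n
  have hc : (0 : ℝ) < ((2 * n).choose n : ℝ) := by exact_mod_cast Nat.choose_pos (by omega)
  rw [centralCoeff, norm_div, norm_mul, norm_pow, norm_pow, norm_two_mul_natCast_add_one,
    Complex.norm_natCast, norm_neg, norm_one, one_pow, div_le_div_iff₀ (by positivity) (by positivity)]
  have : (0 : ℝ) < (2 * n + 1) ^ k := by positivity
  nlinarith

theorem centralCoeff_succ_mul (k n : ℕ) :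
    centralCoeff (k + 1) n * (2 * (n : ℂ) + 1) = centralCoeff k n := by
  have := two_mul_natCast_add_one_ne_zero n
  have := choose_two_mul_ne_zero n
  rw [centralCoeff, centralCoeff, pow_succ]
  field_simp

theorem summable_sq_mul_geometric {r : ℝ} (hr0 : 0 ≤ r) (hr : r < 1) :
    Summable fun n : ℕ => (2 * (n : ℝ) + 1) ^ 2 * r ^ n := by
  have hr' : ‖r‖ < 1 := by rwa [Real.norm_of_nonneg hr0]
  have h := ((summable_pow_mul_geometric_of_norm_lt_one 2 hr').mul_left 4).add
    (((summable_pow_mul_geometric_of_norm_lt_one 1 hr').mul_left 4).add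
      (summable_pow_mul_geometric_of_norm_lt_one 0 hr'))
  refine h.congr fun n => ?_
  ring

theorem norm_centralCoeff_mul_le (k n : ℕ) {r : ℝ} {y : ℂ} (hy : ‖y‖ ≤ r) :
    ‖centralCoeff k n * (2 * (n : ℂ) + 1) * y ^ (2 * n)‖ ≤
      (2 * (n : ℝ) + 1) ^ 2 * (r ^ 2 / 4) ^ n := by
  have h1 := norm_centralCoeff_le k n
  have h2 : (2 * (n : ℝ) + 1) / ((2 * (n : ℝ) + 1) ^ k * 4 ^ n) ≤ (2 * (n : ℝ) + 1) / 4 ^ n := by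
    have : (1 : ℝ) ≤ (2 * (n : ℝ) + 1) ^ k :=
      one_le_pow₀ (by linarith [(Nat.cast_nonneg n : (0 : ℝ) ≤ n)])
    have h4 : (0 : ℝ) < 4 ^ n := by positivity
    exact div_le_div_of_nonneg_left (by positivity) h4 (by nlinarith)
  have h3 : ‖y‖ ^ (2 * n) ≤ (r ^ 2) ^ n := by
    rw [← pow_mul]; exact pow_le_pow_left₀ (norm_nonneg _) hy _
  rw [norm_mul, norm_mul, norm_two_mul_natCast_add_one, norm_pow]
  calc _ ≤ (2 * (n : ℝ) + 1) / 4 ^ n * (2 * n + 1) * (r ^ 2) ^ n := by gcongr; exact h1.trans h2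
    _ = _ := by rw [div_pow]; ring

theorem summable_centralCoeff_deriv (k : ℕ) {y : ℂ} (hy : ‖y‖ < 2) :
    Summable fun n : ℕ => centralCoeff k n * (2 * (n : ℂ) + 1) * y ^ (2 * n) := by
  refine Summable.of_norm_bounded (summable_sq_mul_geometric (r := ‖y‖ ^ 2 / 4) (by positivity) ?_)
    fun n => norm_centralCoeff_mul_le k n le_rfl
  nlinarith [norm_nonneg y]

theorem hasDerivAt_centralSeries_tsum (k : ℕ) {y : ℂ} (hy : ‖y‖ < 2) :
    HasDerivAt (centralSeries k)
      (∑' n : ℕ, centralCoeff k n * (2 * (n : ℂ) + 1) * y ^ (2 * n)) y := by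
  obtain ⟨r, hyr, hr⟩ := exists_between hy
  have hr0 : 0 < r := (norm_nonneg y).trans_lt hyr
  refine hasDerivAt_tsum_of_isPreconnected (t := Metric.ball 0 r) (y₀ := 0)
    (g := fun n y => centralCoeff k n * y ^ (2 * n + 1))
    (g' := fun n y => centralCoeff k n * (2 * (n : ℂ) + 1) * y ^ (2 * n))
    (summable_sq_mul_geometric (r := r ^ 2 / 4) (by positivity) (by nlinarith))
    Metric.isOpen_ball (convex_ball _ _).isPreconnected ?_ ?_ (by simpa using hr0) ?_ (by simpa using hyr)
  · intro n z _
    have := (hasDerivAt_pow (2 * n + 1) z).const_mul (centralCoeff k n)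
    refine this.congr_deriv ?_
    push_cast [Nat.add_sub_cancel]
    ring
  · intro n z hz
    exact norm_centralCoeff_mul_le k n (mem_ball_zero_iff.1 hz).le
  · simp

theorem hasDerivAt_centralSeries (k : ℕ) {y : ℂ} (hy : ‖y‖ < 2) (hy0 : y ≠ 0) :
    HasDerivAt (centralSeries (k + 1)) (centralSeries k y / y) y := by
  refine (hasDerivAt_centralSeries_tsum (k + 1) hy).congr_deriv ?_
  rw [eq_div_iff hy0, ← tsum_mul_right, centralSeries]
  refine tsum_congr fun n => ?_
  rw [centralCoeff_succ_mul]
  ring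

theorem centralCoeff_one_recurrence (n : ℕ) :
    centralCoeff 1 n * (2 * (n : ℂ) + 1) + centralCoeff 1 n +
      4 * (centralCoeff 1 (n + 1) * (2 * ((n + 1 : ℕ) : ℂ) + 1)) = 0 := by
  rw [centralCoeff_succ_mul, centralCoeff_succ_mul]
  have h1 := two_mul_natCast_add_one_ne_zero n
  have h2 := choose_two_mul_ne_zero n
  have h3 := choose_two_mul_ne_zero (n + 1)
  have h : ((n : ℂ) + 1) * ((2 * (n + 1)).choose (n + 1) : ℂ) =
      2 * (2 * n + 1) * ((2 * n).choose n : ℂ) := by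
    exact_mod_cast Nat.succ_mul_centralBinom_succ n
  simp only [centralCoeff, pow_zero, pow_succ]
  field_simp
  linear_combination 2 * (-1) ^ n * h

/-- Coefficients cancel by `centralCoeff_one_recurrence`; the constant `4` is what the `n = 0` term
of the derivative leaves over. -/
theorem centralSeries_one_ode {y : ℂ} (hy : ‖y‖ < 2) :
    (y ^ 2 + 4) * (∑' n : ℕ, centralCoeff 1 n * (2 * (n : ℂ) + 1) * y ^ (2 * n)) +
      y * centralSeries 1 y = 4 := by
  have hs := summable_centralCoeff_deriv 1 hy
  have hs1 : Summable fun n : ℕ => centralCoeff 1 n * y ^ (2 * n + 1) := by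
    have := (summable_centralCoeff_deriv 2 hy).mul_left y
    refine this.congr fun n => ?_
    rw [centralCoeff_succ_mul]; ring
  have hs2 := (summable_nat_add_iff 1).2 hs
  have h0 : ∑' n : ℕ, centralCoeff 1 n * (2 * (n : ℂ) + 1) * y ^ (2 * n) =
      1 + ∑' n : ℕ, centralCoeff 1 (n + 1) * (2 * ((n + 1 : ℕ) : ℂ) + 1) * y ^ (2 * (n + 1)) := by
    rw [hs.tsum_eq_zero_add]
    simp [centralCoeff]
  have h1 : y ^ 2 * (∑' n : ℕ, centralCoeff 1 n * (2 * (n : ℂ) + 1) * y ^ (2 * n)) +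
      (y * centralSeries 1 y +
      4 * ∑' n : ℕ, centralCoeff 1 (n + 1) * (2 * ((n + 1 : ℕ) : ℂ) + 1) * y ^ (2 * (n + 1))) = 0 := by
    rw [centralSeries, ← tsum_mul_left, ← tsum_mul_left, ← tsum_mul_left,
      ← (hs1.mul_left y).tsum_add (hs2.mul_left 4),
      ← (hs.mul_left (y ^ 2)).tsum_add ((hs1.mul_left y).add (hs2.mul_left 4))]
    refine (tsum_congr fun n => ?_).trans tsum_zero
    linear_combination y ^ (2 * n + 2) * centralCoeff_one_recurrence n
  linear_combination h1 + 4 * h0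

/-- On the closed disc the factor `4^n` cancels, leaving a bound of order `1/(2n+1)²`. The series of
weight three thus converges up to the boundary circle. -/
theorem norm_centralCoeff_three_mul_le (n : ℕ) {y : ℂ} (hy : ‖y‖ ≤ 2) :
    ‖centralCoeff 3 n * y ^ (2 * n + 1)‖ ≤ 2 * (1 / ((n : ℝ) + 1) ^ 2) := by
  have h1 := norm_centralCoeff_le 3 n
  have h2 : ‖y‖ ^ (2 * n + 1) ≤ 2 * 4 ^ n := by
    refine (pow_le_pow_left₀ (norm_nonneg y) hy _).trans_eq ?_
    rw [pow_succ, pow_mul]; norm_num; ring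
  rw [norm_mul, norm_pow]
  calc _ ≤ (2 * (n : ℝ) + 1) / ((2 * (n : ℝ) + 1) ^ 3 * 4 ^ n) * (2 * 4 ^ n) := by gcongr
    _ = 2 * (1 / (2 * (n : ℝ) + 1) ^ 2) := by field_simp
    _ ≤ _ := by gcongr; linarith [(Nat.cast_nonneg n : (0 : ℝ) ≤ n)]

theorem summable_two_mul_one_div_add_one_sq :
    Summable fun n : ℕ => 2 * (1 / ((n : ℝ) + 1) ^ 2) :=
  summable_one_div_add_one_sq.mul_left 2

theorem hasSum_centralSeries_three {y : ℂ} (hy : ‖y‖ ≤ 2) :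
    HasSum (fun n : ℕ => centralCoeff 3 n * y ^ (2 * n + 1)) (centralSeries 3 y) :=
  (Summable.of_norm_bounded summable_two_mul_one_div_add_one_sq
    fun n => norm_centralCoeff_three_mul_le n hy).hasSum

theorem continuousOn_centralSeries_three :
    ContinuousOn (centralSeries 3) (Metric.closedBall 0 2) :=
  continuousOn_tsum (fun n => by fun_prop) summable_two_mul_one_div_add_one_sq
    fun n y hy => norm_centralCoeff_three_mul_le n (mem_closedBall_zero_iff.1 hy)

theorem centralSeries_zero (k : ℕ) : centralSeries k 0 = 0 := by
  simp [centralSeries]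

/-! ### The substitution `y = -2 sinh u` -/

theorem normSq_sinh (z : ℂ) :
    Complex.normSq (Complex.sinh z) = Real.sinh z.re ^ 2 + Real.sin z.im ^ 2 := by
  conv_lhs => rw [← Complex.re_add_im z, Complex.sinh_add, Complex.sinh_mul_I, Complex.cosh_mul_I]
  rw [← Complex.ofReal_sinh, ← Complex.ofReal_cosh, ← Complex.ofReal_sin, ← Complex.ofReal_cos,
    Complex.normSq_apply]
  simp only [Complex.add_re, Complex.add_im, Complex.mul_re, Complex.mul_im, Complex.ofReal_re,
    Complex.ofReal_im, Complex.I_re, Complex.I_im]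
  have h1 := Real.cosh_sq z.re
  have h2 := Real.sin_sq_add_cos_sq z.im
  linear_combination Real.sin z.im ^ 2 * h1 + Real.sinh z.re ^ 2 * h2

/-- In `normSq_sinh` both summands are monotone along the ray: `sinh²` always, `sin²` because `|Im
l| ≤ π/2`. At least one is strictly so, since `l ≠ 0`. -/
theorem norm_sinh_real_mul_lt {l : ℂ} (hl : l ≠ 0) (him : |l.im| ≤ Real.pi / 2)
    {t : ℝ} (ht0 : 0 ≤ t) (ht1 : t < 1) :
    ‖Complex.sinh (t * l)‖ < ‖Complex.sinh l‖ := by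
  have hpi := Real.pi_pos
  have hsinh : ∀ x : ℝ, x ≠ 0 → Real.sinh (t * x) ^ 2 < Real.sinh x ^ 2 := by
    intro x hx
    rw [← sq_abs, ← sq_abs (Real.sinh x), Real.abs_sinh, Real.abs_sinh, abs_mul, abs_of_nonneg ht0]
    have hx' := abs_pos.2 hx
    refine pow_lt_pow_left₀ (Real.sinh_lt_sinh.2 (by nlinarith)) (Real.sinh_nonneg_iff.2 (by positivity))
      two_ne_zero
  have hsin : ∀ x : ℝ, x ≠ 0 → |x| ≤ Real.pi / 2 → Real.sin (t * x) ^ 2 < Real.sin x ^ 2 := by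
    intro x hx hxp
    have habs : ∀ u : ℝ, Real.sin u ^ 2 = Real.sin |u| ^ 2 := fun u => by
      rcases abs_choice u with h | h <;> rw [h]
      simp
    rw [habs, habs x, abs_mul, abs_of_nonneg ht0]
    have hx' := abs_pos.2 hx
    have h1 : t * |x| < |x| := by nlinarith
    refine pow_lt_pow_left₀ (Real.sin_lt_sin_of_lt_of_le_pi_div_two ?_ hxp h1)
      (Real.sin_nonneg_of_nonneg_of_le_pi (by positivity) (by linarith)) two_ne_zero
    have : 0 ≤ t * |x| := by positivity
    linarith
  have key : Complex.normSq (Complex.sinh (t * l)) < Complex.normSq (Complex.sinh l) := by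
    rw [normSq_sinh, normSq_sinh]
    simp only [Complex.re_ofReal_mul, Complex.im_ofReal_mul]
    rcases eq_or_ne l.re 0 with h | h
    · have h2 : l.im ≠ 0 := fun h2 => hl (Complex.ext h h2)
      have := hsin _ h2 him
      simp [h]
      exact this
    · have := hsinh _ h
      rcases eq_or_ne l.im 0 with h2 | h2
      · simp [h2]; exact this
      · linarith [hsin _ h2 him]
  rw [Complex.normSq_eq_norm_sq, Complex.normSq_eq_norm_sq] at key
  exact lt_of_pow_lt_pow_left₀ 2 (norm_nonneg _) key

theorem hasDerivAt_real_mul (l : ℂ) (t : ℝ) : HasDerivAt (fun t : ℝ => (t : ℂ) * l) l t := by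
  simpa using (Complex.ofRealCLM.hasDerivAt (x := t)).mul_const l

theorem hasDerivAt_sinh_path (l : ℂ) (t : ℝ) :
    HasDerivAt (fun t : ℝ => -2 * Complex.sinh (t * l)) (-2 * (Complex.cosh (t * l) * l)) t :=
  ((Complex.hasDerivAt_sinh _).comp t (hasDerivAt_real_mul l t)).const_mul (-2)

theorem hasDerivAt_cosh_path (l : ℂ) (t : ℝ) :
    HasDerivAt (fun t : ℝ => Complex.cosh (t * l)) (Complex.sinh (t * l) * l) t :=
  (Complex.hasDerivAt_cosh _).comp t (hasDerivAt_real_mul l t)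

theorem centralSeries_one_sinh {l : ℂ}
    (h : ∀ t : ℝ, 0 ≤ t → t < 1 → ‖-2 * Complex.sinh (t * l)‖ < 2) {t : ℝ} (ht0 : 0 ≤ t) (ht1 : t < 1) :
    centralSeries 1 (-2 * Complex.sinh (t * l)) * Complex.cosh (t * l) = -2 * (t * l) := by
  have hd : ∀ s : ℝ, 0 ≤ s → s < 1 → HasDerivAt (fun s : ℝ =>
      centralSeries 1 (-2 * Complex.sinh (s * l)) * Complex.cosh (s * l)) (-2 * l) s := by
    intro s hs0 hs1
    have h1 := HasDerivAt.comp s (hasDerivAt_centralSeries_tsum 1 (h s hs0 hs1))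
      (hasDerivAt_sinh_path l s)
    refine (h1.mul (hasDerivAt_cosh_path l s)).congr_deriv ?_
    have h2 := centralSeries_one_ode (h s hs0 hs1)
    have h3 := Complex.cosh_sq (s * l)
    simp only [Function.comp]
    set B := ∑' n : ℕ, centralCoeff 1 n * (2 * (n : ℂ) + 1) * (-2 * Complex.sinh (s * l)) ^ (2 * n)
    -- Since `y² + 4 = 4 cosh²`, the differential equation times `-l/2` says that the product has
    -- constant derivative `-2l`.
    linear_combination (-l / 2) * h2 - 2 * l * B * h3
  refine eq_of_hasDerivAt_eq (f' := fun _ => -2 * l) ht0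
    (f := fun s : ℝ => centralSeries 1 (-2 * Complex.sinh (s * l)) * Complex.cosh (s * l))
    (g := fun s : ℝ => -2 * (s * l))
    (fun s hs => (hd s hs.1 (hs.2.trans_lt ht1)).continuousAt.continuousWithinAt) (by fun_prop)
    (fun s hs => hd s hs.1.le (hs.2.trans ht1)) (fun s _ => (hasDerivAt_real_mul l s).const_mul (-2)) ?_
  simp [centralSeries_zero]

/-! ### Logarithms of the four arguments -/

theorem one_sub_re_pos {w : ℂ} (hw : ‖w‖ ≤ 1) (hw1 : w ≠ 1) : 0 < 1 - w.re := by
  have h := (Complex.re_le_norm w).trans hw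
  refine sub_pos.2 (h.lt_of_ne fun h1 => hw1 ?_)
  have h2 := Complex.sq_norm w
  rw [Complex.normSq_apply, h1] at h2
  have h3 : w.im = 0 := by nlinarith [norm_nonneg w, mul_self_nonneg w.im]
  exact Complex.ext h1 h3

/-- The quotient is `((1+w)/2)/w`, and both arguments lie in `(-π/2, π/2)`, so no multiple of `2πi`
appears. -/
theorem log_one_add_inv_div_two {w : ℂ} (hre : 0 < w.re) (him : 0 ≤ w.im) :
    Complex.log ((1 + 1 / w) / 2) = Complex.log ((1 + w) / 2) - Complex.log w := by
  have hw0 : w ≠ 0 := by rintro rfl; simp at hre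
  have ha : (1 + w) / 2 ≠ 0 := by
    intro h; have := congrArg Complex.re h; simp at this; linarith
  have hre2 : 0 < ((1 + w) / 2).re := by simp; linarith
  have him2 : 0 ≤ ((1 + w) / 2).im := by simp; linarith
  have h1 := Complex.abs_arg_lt_pi_div_two_iff.2 (Or.inl hre)
  have h2 := Complex.abs_arg_lt_pi_div_two_iff.2 (Or.inl hre2)
  rw [abs_lt] at h1 h2
  rw [← Complex.log_exp (x := Complex.log ((1 + w) / 2) - Complex.log w), Complex.exp_sub,
    Complex.exp_log ha, Complex.exp_log hw0]
  · congr 1; field_simp; ring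
  · simp only [Complex.sub_im, Complex.log_im]; linarith [h1.2, h2.1]
  · simp only [Complex.sub_im, Complex.log_im]; linarith [h1.1, h2.2]

/-- Here `(1 - 1/w)/2 = -((1-w)/2)/w`. The argument of `(1-w)/2` lies in `(-π/2, 0]` and that of `w`
in `[0, π/2)`, so adding `π` to the difference lands in `(0, π]`. The value `π` occurs for real `w`
and matches the convention on the cut. -/
theorem log_one_sub_inv_div_two {w : ℂ} (hw : ‖w‖ ≤ 1) (hre : 0 < w.re) (him : 0 ≤ w.im)
    (hw1 : w ≠ 1) :
    Complex.log ((1 - 1 / w) / 2) =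
      Complex.log ((1 - w) / 2) - Complex.log w + Real.pi * Complex.I := by
  have hw0 : w ≠ 0 := by rintro rfl; simp at hre
  have hb : (1 - w) / 2 ≠ 0 := div_ne_zero (sub_ne_zero.2 hw1.symm) two_ne_zero
  have hre2 : 0 < ((1 - w) / 2).re := by simpa using one_sub_re_pos hw hw1
  have him2 : ((1 - w) / 2).im ≤ 0 := by simp; linarith
  have h1 := Complex.abs_arg_lt_pi_div_two_iff.2 (Or.inl hre)
  have h2 := Complex.abs_arg_lt_pi_div_two_iff.2 (Or.inl hre2)
  have h3 := Complex.arg_nonneg_iff.2 him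
  have h4 : Complex.arg ((1 - w) / 2) ≤ 0 := by
    rcases him2.lt_or_eq with h | h
    · exact (Complex.arg_neg_iff.2 h).le
    · exact (Complex.arg_eq_zero_iff.2 ⟨hre2.le, h⟩).le
  rw [abs_lt] at h1 h2
  rw [← Complex.log_exp (x := Complex.log ((1 - w) / 2) - Complex.log w + Real.pi * Complex.I),
    Complex.exp_add, Complex.exp_sub, Complex.exp_log hb, Complex.exp_log hw0, Complex.exp_pi_mul_I]
  · congr 1; field_simp; ring
  · simp [Complex.log_im]; linarith [h1.2, h2.1]
  · simp [Complex.log_im]; linarith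

theorem re_inv_pos {w : ℂ} (hre : 0 < w.re) : 0 < (1 / w).re := by
  rw [one_div, Complex.inv_re]
  exact div_pos hre (Complex.normSq_pos.2 (by rintro rfl; simp at hre))

theorem im_inv_nonpos {w : ℂ} (him : 0 ≤ w.im) : (1 / w).im ≤ 0 := by
  rw [one_div, Complex.inv_im]
  exact div_nonpos_of_nonpos_of_nonneg (by linarith) (Complex.normSq_nonneg w)

/-! ### Derivatives along the path `w = exp (t l)` -/

section Path

variable {l : ℂ} {t : ℝ}

theorem exp_real_mul_norm_le_one (hre : l.re ≤ 0) (ht : 0 ≤ t) : ‖Complex.exp (t * l)‖ ≤ 1 := by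
  rw [Complex.norm_exp, Complex.re_ofReal_mul]
  exact Real.exp_le_one_iff.2 (mul_nonpos_of_nonneg_of_nonpos ht hre)

theorem exp_real_mul_re_pos (him : 0 ≤ l.im) (ht : 0 ≤ t) (ht' : t * l.im < Real.pi / 2) :
    0 < (Complex.exp (t * l)).re := by
  rw [Complex.exp_re, Complex.im_ofReal_mul]
  refine mul_pos (Real.exp_pos _) (Real.cos_pos_of_mem_Ioo ⟨?_, ht'⟩)
  linarith [Real.pi_pos, mul_nonneg ht him]

theorem exp_real_mul_im_nonneg (him : 0 ≤ l.im) (ht : 0 ≤ t) (ht' : t * l.im < Real.pi / 2) :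
    0 ≤ (Complex.exp (t * l)).im := by
  rw [Complex.exp_im, Complex.im_ofReal_mul]
  refine mul_nonneg (Real.exp_pos _).le (Real.sin_nonneg_of_nonneg_of_le_pi (mul_nonneg ht him) ?_)
  linarith [Real.pi_pos]

theorem log_exp_real_mul (him : 0 ≤ l.im) (ht : 0 ≤ t) (ht' : t * l.im < Real.pi / 2) :
    Complex.log (Complex.exp (t * l)) = t * l := by
  have := mul_nonneg ht him
  apply Complex.log_exp <;> rw [Complex.im_ofReal_mul] <;> linarith [Real.pi_pos]

theorem exp_real_mul_ne_one (hl : l ≠ 0) (him : 0 ≤ l.im) (ht : 0 < t)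
    (ht' : t * l.im < Real.pi / 2) : Complex.exp (t * l) ≠ 1 := by
  intro h
  have := log_exp_real_mul him ht.le ht'
  rw [h, Complex.log_one] at this
  exact mul_ne_zero (by exact_mod_cast ht.ne') hl this.symm

theorem hasDerivAt_exp_real_mul (l : ℂ) (t : ℝ) :
    HasDerivAt (fun t : ℝ => Complex.exp (t * l)) (Complex.exp (t * l) * l) t :=
  (Complex.hasDerivAt_exp _).comp t (hasDerivAt_real_mul l t)

theorem hasDerivAt_inv_exp_real_mul (l : ℂ) (t : ℝ) :
    HasDerivAt (fun t : ℝ => 1 / Complex.exp (t * l)) (-l / Complex.exp (t * l)) t := by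
  have h := (hasDerivAt_exp_real_mul l t).inv (Complex.exp_ne_zero _)
  simp only [one_div]
  refine h.congr_deriv ?_
  have := Complex.exp_ne_zero (t * l)
  field_simp

/-- The parameters at which the curve `t ↦ exp (t * l)` lies in the region of the identity. -/
structure IsAdmissible (l : ℂ) (t : ℝ) : Prop where
  ne_zero : l ≠ 0
  re_nonpos : l.re ≤ 0
  im_nonneg : 0 ≤ l.im
  pos : 0 < t
  lt : t * l.im < Real.pi / 2

namespace IsAdmissible

theorem norm_le (h : IsAdmissible l t) : ‖Complex.exp (t * l)‖ ≤ 1 :=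
  exp_real_mul_norm_le_one h.re_nonpos h.pos.le

theorem re_pos (h : IsAdmissible l t) : 0 < (Complex.exp (t * l)).re :=
  exp_real_mul_re_pos h.im_nonneg h.pos.le h.lt

theorem exp_im_nonneg (h : IsAdmissible l t) : 0 ≤ (Complex.exp (t * l)).im :=
  exp_real_mul_im_nonneg h.im_nonneg h.pos.le h.lt

theorem ne_one (h : IsAdmissible l t) : Complex.exp (t * l) ≠ 1 :=
  exp_real_mul_ne_one h.ne_zero h.im_nonneg h.pos h.lt

theorem one_sub_ne_zero (h : IsAdmissible l t) : 1 - Complex.exp (t * l) ≠ 0 :=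
  sub_ne_zero.2 h.ne_one.symm

theorem one_add_ne_zero (h : IsAdmissible l t) : 1 + Complex.exp (t * l) ≠ 0 := by
  intro h0
  have h1 := congrArg Complex.re h0
  have h2 := h.re_pos
  simp only [Complex.add_re, Complex.one_re, Complex.zero_re] at h1
  linarith

theorem eventually (h : IsAdmissible l t) : ∀ᶠ s in 𝓝 t, IsAdmissible l s := by
  have h1 : ∀ᶠ s : ℝ in 𝓝 t, 0 < s := eventually_gt_nhds h.pos
  have h2 : ∀ᶠ s : ℝ in 𝓝 t, s * l.im < Real.pi / 2 :=
    (by fun_prop : Continuous fun s : ℝ => s * l.im).continuousAt.eventually (eventually_lt_nhds h.lt)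
  filter_upwards [h1, h2] with s h1 h2 using ⟨h.ne_zero, h.re_nonpos, h.im_nonneg, h1, h2⟩

theorem log_exp (h : IsAdmissible l t) : Complex.log (Complex.exp (t * l)) = t * l :=
  log_exp_real_mul h.im_nonneg h.pos.le h.lt

theorem one_add_mem (h : IsAdmissible l t) : (1 + Complex.exp (t * l)) / 2 ∈ Complex.slitPlane := by
  have := h.re_pos
  left; simp only [Complex.div_ofNat_re, Complex.add_re, Complex.one_re]; linarith

theorem one_sub_mem (h : IsAdmissible l t) : (1 - Complex.exp (t * l)) / 2 ∈ Complex.slitPlane := by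
  have := one_sub_re_pos h.norm_le h.ne_one
  left; simp only [Complex.div_ofNat_re, Complex.sub_re, Complex.one_re]; linarith

theorem one_add_inv_mem (h : IsAdmissible l t) :
    (1 + 1 / Complex.exp (t * l)) / 2 ∈ Complex.slitPlane := by
  have := re_inv_pos h.re_pos
  left; simp only [Complex.div_ofNat_re, Complex.add_re, Complex.one_re]; linarith

theorem one_add_inv_im_nonpos (h : IsAdmissible l t) :
    ((1 + 1 / Complex.exp (t * l)) / 2).im ≤ 0 := by
  have := im_inv_nonpos h.exp_im_nonneg
  simp only [Complex.div_ofNat_im, Complex.add_im, Complex.one_im]; linarith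

theorem inv_ne_one (h : IsAdmissible l t) : 1 / Complex.exp (t * l) ≠ 1 := by
  rw [one_div, ne_eq, inv_eq_one]; exact h.ne_one

theorem one_sub_one_add_div_two (w : ℂ) : 1 - (1 + w) / 2 = (1 - w) / 2 := by ring

theorem one_sub_one_sub_div_two (w : ℂ) : 1 - (1 - w) / 2 = (1 + w) / 2 := by ring

theorem one_sub_inv_div_two_ne_zero (h : IsAdmissible l t) :
    (1 - 1 / Complex.exp (t * l)) / 2 ≠ 0 :=
  div_ne_zero (sub_ne_zero.2 h.inv_ne_one.symm) two_ne_zero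

theorem hasDerivAt_log_one_add (h : IsAdmissible l t) :
    HasDerivAt (fun t : ℝ => Complex.log ((1 + Complex.exp (t * l)) / 2))
      (Complex.exp (t * l) * l / (1 + Complex.exp (t * l))) t := by
  have h1 := (((hasDerivAt_exp_real_mul l t).const_add 1).div_const 2).clog_real h.one_add_mem
  refine h1.congr_deriv ?_
  have := h.one_add_ne_zero
  field_simp

theorem hasDerivAt_log_one_sub (h : IsAdmissible l t) :
    HasDerivAt (fun t : ℝ => Complex.log ((1 - Complex.exp (t * l)) / 2))
      (-(Complex.exp (t * l) * l) / (1 - Complex.exp (t * l))) t := by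
  have h1 := (((hasDerivAt_exp_real_mul l t).const_sub 1).div_const 2).clog_real h.one_sub_mem
  refine h1.congr_deriv ?_
  have := h.one_sub_ne_zero
  field_simp

theorem hasDerivAt_dilog_one_add (h : IsAdmissible l t) :
    HasDerivAt (fun t : ℝ => dilog ((1 + Complex.exp (t * l)) / 2))
      (-Complex.log ((1 - Complex.exp (t * l)) / 2) * Complex.exp (t * l) * l /
        (1 + Complex.exp (t * l))) t := by
  have h1 := (hasDerivAt_dilog (by rw [one_sub_one_add_div_two]; exact h.one_sub_mem)
    (Complex.slitPlane_ne_zero h.one_add_mem)).comp t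
    (((hasDerivAt_exp_real_mul l t).const_add 1).div_const 2)
  refine h1.congr_deriv ?_
  have := h.one_add_ne_zero
  rw [one_sub_one_add_div_two]
  field_simp

theorem hasDerivAt_trilog_one_add (h : IsAdmissible l t) :
    HasDerivAt (fun t : ℝ => trilog ((1 + Complex.exp (t * l)) / 2))
      (dilog ((1 + Complex.exp (t * l)) / 2) * Complex.exp (t * l) * l /
        (1 + Complex.exp (t * l))) t := by
  have h1 := (hasDerivAt_trilog (by rw [one_sub_one_add_div_two]; exact h.one_sub_mem)
    (Complex.slitPlane_ne_zero h.one_add_mem)).comp t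
    (((hasDerivAt_exp_real_mul l t).const_add 1).div_const 2)
  refine h1.congr_deriv ?_
  have := h.one_add_ne_zero
  field_simp

theorem hasDerivAt_dilog_one_sub (h : IsAdmissible l t) :
    HasDerivAt (fun t : ℝ => dilog ((1 - Complex.exp (t * l)) / 2))
      (Complex.log ((1 + Complex.exp (t * l)) / 2) * Complex.exp (t * l) * l /
        (1 - Complex.exp (t * l))) t := by
  have h1 := (hasDerivAt_dilog (by rw [one_sub_one_sub_div_two]; exact h.one_add_mem)
    (Complex.slitPlane_ne_zero h.one_sub_mem)).comp t
    (((hasDerivAt_exp_real_mul l t).const_sub 1).div_const 2)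
  refine h1.congr_deriv ?_
  have := h.one_sub_ne_zero
  rw [one_sub_one_sub_div_two]
  field_simp

theorem hasDerivAt_trilog_one_sub (h : IsAdmissible l t) :
    HasDerivAt (fun t : ℝ => trilog ((1 - Complex.exp (t * l)) / 2))
      (-dilog ((1 - Complex.exp (t * l)) / 2) * Complex.exp (t * l) * l /
        (1 - Complex.exp (t * l))) t := by
  have h1 := (hasDerivAt_trilog (by rw [one_sub_one_sub_div_two]; exact h.one_add_mem)
    (Complex.slitPlane_ne_zero h.one_sub_mem)).comp t
    (((hasDerivAt_exp_real_mul l t).const_sub 1).div_const 2)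
  refine h1.congr_deriv ?_
  have := h.one_sub_ne_zero
  field_simp

/-- For real `w` the argument runs along the cut, so the version for curves in the closed lower half
plane is needed. The term `πi` comes from `log ((1 - 1/w)/2)`. -/
theorem hasDerivAt_dilog_one_add_inv (h : IsAdmissible l t) :
    HasDerivAt (fun t : ℝ => dilog ((1 + 1 / Complex.exp (t * l)) / 2))
      ((Complex.log ((1 - Complex.exp (t * l)) / 2) - t * l + Real.pi * Complex.I) * l /
        (1 + Complex.exp (t * l))) t := by
  have h1 := hasDerivAt_dilog_comp (((hasDerivAt_inv_exp_real_mul l t).const_add 1).div_const 2)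
    (h.eventually.mono fun s hs => hs.one_add_inv_im_nonpos)
    (Complex.slitPlane_ne_zero h.one_add_inv_mem) (fun h0 => h.inv_ne_one (by linear_combination 2 * h0))
  refine h1.congr_deriv ?_
  have h2 := h.one_add_ne_zero
  have h3 := Complex.exp_ne_zero (t * l)
  rw [one_sub_one_add_div_two, log_one_sub_inv_div_two h.norm_le h.re_pos h.exp_im_nonneg h.ne_one,
    h.log_exp]
  have h4 : 1 + 1 / Complex.exp (t * l) = (1 + Complex.exp (t * l)) / Complex.exp (t * l) := by
    field_simp; ring
  rw [h4]
  field_simp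

theorem hasDerivAt_trilog_one_add_inv (h : IsAdmissible l t) :
    HasDerivAt (fun t : ℝ => trilog ((1 + 1 / Complex.exp (t * l)) / 2))
      (-dilog ((1 + 1 / Complex.exp (t * l)) / 2) * l / (1 + Complex.exp (t * l))) t := by
  have h1 := hasDerivAt_trilog_comp (((hasDerivAt_inv_exp_real_mul l t).const_add 1).div_const 2)
    (h.eventually.mono fun s hs => hs.one_add_inv_im_nonpos)
    (Complex.slitPlane_ne_zero h.one_add_inv_mem)
  refine h1.congr_deriv ?_
  have h2 := h.one_add_ne_zero
  have h3 := Complex.exp_ne_zero (t * l)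
  generalize dilog ((1 + 1 / Complex.exp (t * l)) / 2) = d
  have h4 : 1 + 1 / Complex.exp (t * l) = (1 + Complex.exp (t * l)) / Complex.exp (t * l) := by
    field_simp; ring
  rw [h4]
  field_simp

theorem hasDerivAt_dilog_one_sub_inv (h : IsAdmissible l t) :
    HasDerivAt (fun t : ℝ => dilog ((1 - 1 / Complex.exp (t * l)) / 2))
      ((Complex.log ((1 + Complex.exp (t * l)) / 2) - t * l) * l / (1 - Complex.exp (t * l))) t := by
  have h1 := (hasDerivAt_dilog (by rw [one_sub_one_sub_div_two]; exact h.one_add_inv_mem)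
    h.one_sub_inv_div_two_ne_zero).comp t
    (((hasDerivAt_inv_exp_real_mul l t).const_sub 1).div_const 2)
  refine h1.congr_deriv ?_
  have h2 := h.one_sub_ne_zero
  have h2' := sub_ne_zero.2 h.ne_one
  have h3 := Complex.exp_ne_zero (t * l)
  rw [one_sub_one_sub_div_two, log_one_add_inv_div_two h.re_pos h.exp_im_nonneg, h.log_exp]
  have h4 : 1 - 1 / Complex.exp (t * l) = -(1 - Complex.exp (t * l)) / Complex.exp (t * l) := by
    field_simp; ring
  rw [h4]
  field_simp

theorem hasDerivAt_trilog_one_sub_inv (h : IsAdmissible l t) :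
    HasDerivAt (fun t : ℝ => trilog ((1 - 1 / Complex.exp (t * l)) / 2))
      (-dilog ((1 - 1 / Complex.exp (t * l)) / 2) * l / (1 - Complex.exp (t * l))) t := by
  have h1 := (hasDerivAt_trilog (by rw [one_sub_one_sub_div_two]; exact h.one_add_inv_mem)
    h.one_sub_inv_div_two_ne_zero).comp t
    (((hasDerivAt_inv_exp_real_mul l t).const_sub 1).div_const 2)
  refine h1.congr_deriv ?_
  have h2 := h.one_sub_ne_zero
  have h3 := Complex.exp_ne_zero (t * l)
  generalize dilog ((1 - 1 / Complex.exp (t * l)) / 2) = d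
  have h4 : 1 - 1 / Complex.exp (t * l) = -(1 - Complex.exp (t * l)) / Complex.exp (t * l) := by
    field_simp; ring
  rw [h4]
  field_simp

end IsAdmissible

end Path

theorem isAdmissible_of_mem_Ioc {l : ℂ} (hl : l ≠ 0) (hre : l.re ≤ 0) (him : 0 ≤ l.im)
    (him' : l.im < Real.pi / 2) {t : ℝ} (ht : t ∈ Ioc (0 : ℝ) 1) : IsAdmissible l t :=
  ⟨hl, hre, him, ht.1, (mul_le_of_le_one_left him ht.2).trans_lt him'⟩

/-! ### Behaviour at the starting point `w = 1` -/

/-- Factor `(1 - exp (t l))/2 = t κ(t)` with `κ(0) = -l/2` in the slit plane. Then `log` splits as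
`log t + log κ(t)` for small `t > 0`, and `t log t → 0`. -/
theorem continuousWithinAt_mul_log_one_sub_exp {l : ℂ} (hl : l ≠ 0) (hre : l.re ≤ 0) :
    ContinuousWithinAt (fun t : ℝ => t * l * Complex.log ((1 - Complex.exp (t * l)) / 2))
      (Icc 0 1) 0 := by
  set g : ℝ → ℂ := fun t => (1 - Complex.exp (t * l)) / 2 with hg
  have hgd : HasDerivAt g (-l / 2) 0 := by
    have := ((hasDerivAt_exp_real_mul l 0).const_sub 1).div_const 2
    simpa using this
  have hg0 : g 0 = 0 := by simp [hg]
  have hκ : ContinuousAt (dslope g 0) 0 := continuousAt_dslope_same.2 hgd.differentiableAt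
  have hκ0 : dslope g 0 0 ∈ Complex.slitPlane := by
    rw [dslope_same, hgd.deriv, Complex.mem_slitPlane_iff]
    rcases hre.lt_or_eq with h | h
    · left; simp; linarith
    · right
      have : l.im ≠ 0 := fun h2 => hl (Complex.ext h h2)
      simpa using this
  have hmain : ContinuousAt (fun t : ℝ => l * ((t * Real.log t : ℝ) : ℂ) +
      t * l * Complex.log (dslope g 0 t)) 0 := by
    refine ContinuousAt.add ?_ ?_
    · exact (continuous_const.mul (Complex.continuous_ofReal.comp Real.continuous_mul_log)).continuousAt
    · exact (by fun_prop : Continuous fun t : ℝ => (t : ℂ) * l).continuousAt.mul (hκ.clog hκ0)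
  refine hmain.continuousWithinAt.congr_of_eventuallyEq ?_ (by simp)
  have hev : ∀ᶠ t in 𝓝 (0 : ℝ), dslope g 0 t ∈ Complex.slitPlane :=
    hκ.eventually (Complex.isOpen_slitPlane.mem_nhds hκ0)
  filter_upwards [self_mem_nhdsWithin, mem_nhdsWithin_of_mem_nhds hev] with t ht hts
  rcases ht.1.eq_or_lt with h0 | h0
  · simp [← h0]
  · have h1 : g t = (t : ℂ) * dslope g 0 t := by
      have := sub_smul_dslope g 0 t
      rw [hg0, sub_zero, sub_zero, Complex.real_smul] at this
      exact this.symm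
    change t * l * Complex.log (g t) = _
    rw [h1, Complex.log_ofReal_mul h0 (Complex.slitPlane_ne_zero hts)]
    push_cast
    ring

/-! ### The closed forms: derivatives and continuity -/

section Path

variable {l : ℂ}

theorem continuousWithinAt_comp_one_add {P : ℂ → ℂ} (hP : ContinuousOn P (Metric.closedBall 0 1))
    (hre : l.re ≤ 0) :
    ContinuousWithinAt (fun t : ℝ => P ((1 + Complex.exp (t * l)) / 2)) (Icc 0 1) 0 := by
  refine (hP ((1 + Complex.exp ((0 : ℝ) * l)) / 2) (by simp)).comp
    (f := fun t : ℝ => (1 + Complex.exp (t * l)) / 2) (by fun_prop) fun t ht => ?_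
  have := exp_real_mul_norm_le_one hre ht.1
  rw [mem_closedBall_zero_iff, norm_div, Complex.norm_ofNat, div_le_one two_pos]
  refine (norm_add_le _ _).trans ?_
  rw [norm_one]; linarith

theorem continuousWithinAt_comp_one_add_inv {P : ℂ → ℂ} (hP : ContinuousOn P {z : ℂ | z.im ≤ 0})
    (him : 0 ≤ l.im) (him' : l.im < Real.pi / 2) :
    ContinuousWithinAt (fun t : ℝ => P ((1 + 1 / Complex.exp (t * l)) / 2)) (Icc 0 1) 0 := by
  refine (hP ((1 + 1 / Complex.exp ((0 : ℝ) * l)) / 2) (by simp)).comp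
    (f := fun t : ℝ => (1 + 1 / Complex.exp (t * l)) / 2) ?_ fun t ht => ?_
  · simp only [one_div, ← Complex.exp_neg]; fun_prop
  · have := im_inv_nonpos (exp_real_mul_im_nonneg him ht.1
      ((mul_le_of_le_one_left him ht.2).trans_lt him'))
    rw [mem_ofPred_eq, Complex.div_ofNat_im, Complex.add_im, Complex.one_im]; linarith

theorem continuousWithinAt_comp_one_sub {P : ℂ → ℂ}
    (hP : DifferentiableOn ℂ P {z | 1 - z ∈ Complex.slitPlane}) :
    ContinuousWithinAt (fun t : ℝ => P ((1 - Complex.exp (t * l)) / 2)) (Icc 0 1) 0 := by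
  refine ContinuousAt.continuousWithinAt (ContinuousAt.comp
    (f := fun t : ℝ => (1 - Complex.exp (t * l)) / 2)
    (hP.continuousOn.continuousAt (isOpen_cutPlane.mem_nhds (by simp))) ?_)
  fun_prop

theorem continuousWithinAt_comp_one_sub_inv {P : ℂ → ℂ}
    (hP : DifferentiableOn ℂ P {z | 1 - z ∈ Complex.slitPlane}) :
    ContinuousWithinAt (fun t : ℝ => P ((1 - 1 / Complex.exp (t * l)) / 2)) (Icc 0 1) 0 := by
  refine ContinuousAt.continuousWithinAt (ContinuousAt.comp
    (f := fun t : ℝ => (1 - 1 / Complex.exp (t * l)) / 2)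
    (hP.continuousOn.continuousAt (isOpen_cutPlane.mem_nhds (by simp))) ?_)
  simp only [one_div, ← Complex.exp_neg]; fun_prop

theorem continuousWithinAt_log_one_add_exp :
    ContinuousWithinAt (fun t : ℝ => Complex.log ((1 + Complex.exp (t * l)) / 2)) (Icc 0 1) 0 := by
  refine ContinuousWithinAt.clog (by fun_prop) ?_
  simp

theorem continuousWithinAt_real_mul : ContinuousWithinAt (fun t : ℝ => (t : ℂ) * l) (Icc 0 1) 0 := by
  fun_prop

/-- The antiderivative of `4 log w / (1 - w²)`, along `w = exp (t * l)`. -/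
noncomputable def dilogPrimitive (l : ℂ) (t : ℝ) : ℂ :=
  2 * (dilog ((1 + 1 / Complex.exp (t * l)) / 2) - dilog ((1 + Complex.exp (t * l)) / 2))
    - 2 * (t * l * Complex.log ((1 - Complex.exp (t * l)) / 2))
    + 2 * (Real.pi * Complex.I) * Complex.log ((1 + Complex.exp (t * l)) / 2)
    + (t * l) ^ 2 - 2 * (Real.pi * Complex.I) * (t * l)

/-- The combination of dilogarithms that vanishes by two instances of Euler's reflection formula,
along `w = exp (t * l)`. -/
noncomputable def dilogReflection (l : ℂ) (t : ℝ) : ℂ :=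
  dilog ((1 + Complex.exp (t * l)) / 2) - dilog ((1 + 1 / Complex.exp (t * l)) / 2)
    + dilog ((1 - Complex.exp (t * l)) / 2) - dilog ((1 - 1 / Complex.exp (t * l)) / 2)
    + t * l * Complex.log ((1 + Complex.exp (t * l)) / 2)
    + t * l * Complex.log ((1 - Complex.exp (t * l)) / 2)
    - Real.pi * Complex.I * Complex.log ((1 + Complex.exp (t * l)) / 2)
    - (t * l) ^ 2 + Real.pi * Complex.I * (t * l)

/-- The closed form of the series along `w = exp (t * l)`. -/
noncomputable def trilogPrimitive (l : ℂ) (t : ℝ) : ℂ :=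
  -2 * (trilog ((1 + Complex.exp (t * l)) / 2) - trilog ((1 - Complex.exp (t * l)) / 2)
      - trilog ((1 + 1 / Complex.exp (t * l)) / 2) + trilog ((1 - 1 / Complex.exp (t * l)) / 2))
    + (dilog ((1 + Complex.exp (t * l)) / 2) - dilog ((1 - Complex.exp (t * l)) / 2)
      + dilog ((1 + 1 / Complex.exp (t * l)) / 2) - dilog ((1 - 1 / Complex.exp (t * l)) / 2))
      * (t * l)
    + Real.pi * Complex.I * Complex.log ((1 + Complex.exp (t * l)) / 2)
      * (Complex.log ((1 + Complex.exp (t * l)) / 2) - t * l)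

theorem IsAdmissible.one_sub_sq_ne_zero {t : ℝ} (h : IsAdmissible l t) :
    1 - Complex.exp (t * l) ^ 2 ≠ 0 := by
  have := mul_ne_zero h.one_sub_ne_zero h.one_add_ne_zero
  intro h0
  exact this (by linear_combination h0)

theorem IsAdmissible.hasDerivAt_dilogPrimitive {t : ℝ} (h : IsAdmissible l t) :
    HasDerivAt (dilogPrimitive l)
      (4 * (t * l) * (Complex.exp (t * l) * l) / (1 - Complex.exp (t * l) ^ 2)) t := by
  have hL := hasDerivAt_real_mul l t
  have := ((((h.hasDerivAt_dilog_one_add_inv.sub h.hasDerivAt_dilog_one_add).const_mul 2).sub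
    ((hL.mul h.hasDerivAt_log_one_sub).const_mul 2)).add
    (h.hasDerivAt_log_one_add.const_mul (2 * (Real.pi * Complex.I)))).add (hL.pow 2) |>.sub
    (hL.const_mul (2 * (Real.pi * Complex.I)))
  refine this.congr_deriv ?_
  have h1 := h.one_add_ne_zero
  have h2 := h.one_sub_ne_zero
  rw [show 1 - Complex.exp (t * l) ^ 2 = (1 - Complex.exp (t * l)) * (1 + Complex.exp (t * l)) by ring]
  generalize Complex.exp (t * l) = w at *
  generalize Complex.log ((1 - w) / 2) = β at *
  field_simp
  push_cast
  ring

/-- The combination is the difference of `Li₂(z) + Li₂(1-z) + log z log (1-z)` at `z = (1+w)/2` and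
at `z = (1+1/w)/2`; each of these is constant. -/
theorem IsAdmissible.hasDerivAt_dilogReflection {t : ℝ} (h : IsAdmissible l t) :
    HasDerivAt (dilogReflection l) 0 t := by
  have hL := hasDerivAt_real_mul l t
  have := (((((((h.hasDerivAt_dilog_one_add.sub h.hasDerivAt_dilog_one_add_inv).add
    h.hasDerivAt_dilog_one_sub).sub h.hasDerivAt_dilog_one_sub_inv).add
    (hL.mul h.hasDerivAt_log_one_add)).add (hL.mul h.hasDerivAt_log_one_sub)).sub
    (h.hasDerivAt_log_one_add.const_mul (Real.pi * Complex.I))).sub (hL.pow 2)).add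
    (hL.const_mul (Real.pi * Complex.I))
  refine this.congr_deriv ?_
  have h1 := h.one_add_ne_zero
  have h2 := h.one_sub_ne_zero
  generalize Complex.exp (t * l) = w at *
  generalize Complex.log ((1 - w) / 2) = β at *
  generalize Complex.log ((1 + w) / 2) = α at *
  field_simp
  push_cast
  ring

theorem continuousOn_Icc_of_hasDerivAt {f : ℝ → ℂ} {f' : ℝ → ℂ}
    (h0 : ContinuousWithinAt f (Icc 0 1) 0) (h : ∀ t ∈ Ioc (0 : ℝ) 1, HasDerivAt f (f' t) t) :
    ContinuousOn f (Icc 0 1) := by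
  intro t ht
  rcases ht.1.eq_or_lt with rfl | h1
  · exact h0
  · exact (h t ⟨h1, ht.2⟩).continuousAt.continuousWithinAt

variable (hl : l ≠ 0) (hre : l.re ≤ 0) (him : 0 ≤ l.im) (him' : l.im < Real.pi / 2)
include hl hre him him'

theorem continuousOn_dilogPrimitive : ContinuousOn (dilogPrimitive l) (Icc 0 1) := by
  refine continuousOn_Icc_of_hasDerivAt ?_ fun t ht =>
    (isAdmissible_of_mem_Ioc hl hre him him' ht).hasDerivAt_dilogPrimitive
  have hL := continuousWithinAt_real_mul (l := l)
  exact (((continuousWithinAt_const.mul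
    ((continuousWithinAt_comp_one_add_inv continuousOn_dilog him him').sub
      (continuousWithinAt_comp_one_add continuousOn_dilog_closedBall hre))).sub
    (continuousWithinAt_const.mul (continuousWithinAt_mul_log_one_sub_exp hl hre))).add
    (continuousWithinAt_const.mul continuousWithinAt_log_one_add_exp)).add (hL.pow 2) |>.sub
    (continuousWithinAt_const.mul hL)

theorem continuousOn_dilogReflection : ContinuousOn (dilogReflection l) (Icc 0 1) := by
  refine continuousOn_Icc_of_hasDerivAt (f' := fun _ => 0) ?_ fun t ht =>
    (isAdmissible_of_mem_Ioc hl hre him him' ht).hasDerivAt_dilogReflection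
  have hL := continuousWithinAt_real_mul (l := l)
  have hlog := continuousWithinAt_log_one_add_exp (l := l)
  exact ((((((((continuousWithinAt_comp_one_add continuousOn_dilog_closedBall hre).sub
    (continuousWithinAt_comp_one_add_inv continuousOn_dilog him him')).add
    (continuousWithinAt_comp_one_sub differentiableOn_dilog)).sub
    (continuousWithinAt_comp_one_sub_inv differentiableOn_dilog)).add (hL.mul hlog)).add
    (continuousWithinAt_mul_log_one_sub_exp hl hre)).sub (continuousWithinAt_const.mul hlog)).sub
    (hL.pow 2)).add (continuousWithinAt_const.mul hL)

theorem dilogReflection_eq_zero {t : ℝ} (ht : t ∈ Icc (0 : ℝ) 1) : dilogReflection l t = 0 := by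
  refine eq_of_hasDerivAt_eq (g := fun _ => 0) (f' := fun _ => 0) ht.1
    ((continuousOn_dilogReflection hl hre him him').mono (Icc_subset_Icc_right ht.2))
    continuousOn_const (fun s hs => ?_) (fun s _ => hasDerivAt_const s 0) ?_
  · exact (isAdmissible_of_mem_Ioc hl hre him him'
      ⟨hs.1, hs.2.le.trans ht.2⟩).hasDerivAt_dilogReflection
  · simp [dilogReflection]

theorem hasDerivAt_trilogPrimitive {t : ℝ} (ht : t ∈ Ioc (0 : ℝ) 1) :
    HasDerivAt (trilogPrimitive l)
      (-(1 + Complex.exp (t * l) ^ 2) / (1 - Complex.exp (t * l) ^ 2) * l * dilogPrimitive l t) t := by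
  have h := isAdmissible_of_mem_Ioc hl hre him him' ht
  have hL := hasDerivAt_real_mul l t
  have := ((((h.hasDerivAt_trilog_one_add.sub h.hasDerivAt_trilog_one_sub).sub
    h.hasDerivAt_trilog_one_add_inv).add h.hasDerivAt_trilog_one_sub_inv).const_mul (-2)).add
    ((((h.hasDerivAt_dilog_one_add.sub h.hasDerivAt_dilog_one_sub).add
    h.hasDerivAt_dilog_one_add_inv).sub h.hasDerivAt_dilog_one_sub_inv).mul hL) |>.add
    ((h.hasDerivAt_log_one_add.const_mul (Real.pi * Complex.I)).mul
      (h.hasDerivAt_log_one_add.sub hL))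
  refine this.congr_deriv ?_
  have h1 := h.one_add_ne_zero
  have h2 := h.one_sub_ne_zero
  have h3 := dilogReflection_eq_zero hl hre him him' ⟨ht.1.le, ht.2⟩
  rw [show 1 - Complex.exp (t * l) ^ 2 = (1 - Complex.exp (t * l)) * (1 + Complex.exp (t * l)) by ring]
  rw [dilogReflection] at h3
  rw [dilogPrimitive]
  simp only [Pi.sub_apply, Pi.add_apply]
  generalize dilog ((1 - 1 / Complex.exp (t * l)) / 2) = d₁ at *
  generalize dilog ((1 + 1 / Complex.exp (t * l)) / 2) = d₂ at *
  generalize Complex.exp (t * l) = w at *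
  generalize dilog ((1 - w) / 2) = d₃ at *
  generalize dilog ((1 + w) / 2) = d₄ at *
  generalize Complex.log ((1 - w) / 2) = β at *
  generalize Complex.log ((1 + w) / 2) = α at *
  field_simp
  -- The computed derivative and the required one differ by a multiple of the vanishing reflection
  -- combination.
  linear_combination (-(1 + w) ^ 2) * h3

theorem continuousOn_trilogPrimitive : ContinuousOn (trilogPrimitive l) (Icc 0 1) := by
  refine continuousOn_Icc_of_hasDerivAt ?_ fun t ht => hasDerivAt_trilogPrimitive hl hre him him' ht
  have hL := continuousWithinAt_real_mul (l := l)
  have hlog := continuousWithinAt_log_one_add_exp (l := l)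
  exact ((continuousWithinAt_const.mul ((((continuousWithinAt_comp_one_add
    continuousOn_trilog_closedBall hre).sub
    (continuousWithinAt_comp_one_sub differentiableOn_trilog)).sub
    (continuousWithinAt_comp_one_add_inv continuousOn_trilog him him')).add
    (continuousWithinAt_comp_one_sub_inv differentiableOn_trilog))).add
    (((((continuousWithinAt_comp_one_add continuousOn_dilog_closedBall hre).sub
    (continuousWithinAt_comp_one_sub differentiableOn_dilog)).add
    (continuousWithinAt_comp_one_add_inv continuousOn_dilog him him')).sub
    (continuousWithinAt_comp_one_sub_inv differentiableOn_dilog)).mul hL)).add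
    ((continuousWithinAt_const.mul hlog).mul (hlog.sub hL))

/-! ### Identification of the series with the closed forms -/

omit hre in
theorem norm_two_mul_sinh_lt (hn : ‖-2 * Complex.sinh l‖ ≤ 2) (t : ℝ) (ht0 : 0 ≤ t) (ht1 : t < 1) :
    ‖-2 * Complex.sinh (t * l)‖ < 2 := by
  have h := norm_sinh_real_mul_lt hl (by rw [abs_of_nonneg him]; exact him'.le) ht0 ht1
  simp only [norm_mul, norm_neg, Complex.norm_ofNat] at *
  linarith

omit hl hre him him' in
theorem neg_two_mul_sinh (z : ℂ) :
    -2 * Complex.sinh z = (1 - Complex.exp z ^ 2) / Complex.exp z := by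
  have := Complex.exp_ne_zero z
  rw [Complex.sinh, Complex.exp_neg]
  field_simp
  ring

omit hl hre him him' in
theorem two_mul_cosh (z : ℂ) :
    2 * Complex.cosh z = (1 + Complex.exp z ^ 2) / Complex.exp z := by
  have := Complex.exp_ne_zero z
  rw [Complex.cosh, Complex.exp_neg]
  field_simp
  ring

omit hl hre him him' in
theorem IsAdmissible.neg_two_mul_sinh_ne_zero {t : ℝ} (h : IsAdmissible l t) :
    -2 * Complex.sinh (t * l) ≠ 0 := by
  rw [neg_two_mul_sinh]
  exact div_ne_zero h.one_sub_sq_ne_zero (Complex.exp_ne_zero _)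

/-- Both sides have derivative `4 log w / (1 - w²) · dw/dt` and vanish at `t = 0`. The endpoint `t =
1` is excluded because `y` may lie on the circle `|y| = 2`, where the series of weight two is not
controlled. -/
theorem centralSeries_two_sinh (hn : ‖-2 * Complex.sinh l‖ ≤ 2) {t : ℝ} (ht0 : 0 ≤ t) (ht1 : t < 1) :
    centralSeries 2 (-2 * Complex.sinh (t * l)) = dilogPrimitive l t := by
  have hlt := norm_two_mul_sinh_lt hl him him' hn
  refine eq_of_hasDerivAt_eq (f := fun s : ℝ => centralSeries 2 (-2 * Complex.sinh (s * l))) ht0 ?_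
    ((continuousOn_dilogPrimitive hl hre him him').mono (Icc_subset_Icc_right ht1.le)) ?_
    (fun s hs => (isAdmissible_of_mem_Ioc hl hre him him'
      ⟨hs.1, (hs.2.trans ht1).le⟩).hasDerivAt_dilogPrimitive) ?_
  · intro s hs
    exact (HasDerivAt.comp s (hasDerivAt_centralSeries_tsum 2 (hlt s hs.1 (hs.2.trans_lt ht1)))
      (hasDerivAt_sinh_path l s)).continuousAt.continuousWithinAt
  · intro s hs
    have h := isAdmissible_of_mem_Ioc hl hre him him' ⟨hs.1, (hs.2.trans ht1).le⟩
    refine (HasDerivAt.comp s (hasDerivAt_centralSeries 1 (hlt s hs.1.le (hs.2.trans ht1))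
      h.neg_two_mul_sinh_ne_zero) (hasDerivAt_sinh_path l s)).congr_deriv ?_
    have h1 := centralSeries_one_sinh hlt hs.1.le (hs.2.trans ht1)
    have h2 := h.one_sub_sq_ne_zero
    have h3 := Complex.exp_ne_zero (s * l)
    calc _ = (-2 * l) * (centralSeries 1 (-2 * Complex.sinh (s * l)) * Complex.cosh (s * l)) /
          (-2 * Complex.sinh (s * l)) := by ring
      _ = _ := by rw [h1, neg_two_mul_sinh]; field_simp; ring
  · simp [centralSeries_zero, dilogPrimitive]

/-- The endpoint `t = 1` is now allowed: derivatives are compared only for `0 < t < 1`, and both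
sides are continuous on the closed interval. -/
theorem centralSeries_three_sinh (hn : ‖-2 * Complex.sinh l‖ ≤ 2) :
    centralSeries 3 (-2 * Complex.sinh l) = trilogPrimitive l 1 := by
  have hlt := norm_two_mul_sinh_lt hl him him' hn
  have key := eq_of_hasDerivAt_eq (f := fun s : ℝ => centralSeries 3 (-2 * Complex.sinh (s * l)))
    zero_le_one ?_ (continuousOn_trilogPrimitive hl hre him him') ?_
    (fun s hs => hasDerivAt_trilogPrimitive hl hre him him' ⟨hs.1, hs.2.le⟩) ?_
  · simpa using key
  · refine continuousOn_centralSeries_three.comp (by fun_prop) fun s hs => ?_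
    rw [mem_closedBall_zero_iff]
    rcases hs.2.eq_or_lt with rfl | h1
    · simpa using hn
    · exact (hlt s hs.1 h1).le
  · intro s hs
    have h := isAdmissible_of_mem_Ioc hl hre him him' ⟨hs.1, hs.2.le⟩
    refine (HasDerivAt.comp s (hasDerivAt_centralSeries 2 (hlt s hs.1.le hs.2)
      h.neg_two_mul_sinh_ne_zero) (hasDerivAt_sinh_path l s)).congr_deriv ?_
    have h2 := h.one_sub_sq_ne_zero
    have h3 := Complex.exp_ne_zero (s * l)
    rw [centralSeries_two_sinh hl hre him him' hn hs.1.le hs.2,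
      show -2 * (Complex.cosh (s * l) * l) = -(2 * Complex.cosh (s * l)) * l by ring,
      neg_two_mul_sinh, two_mul_cosh]
    field_simp
  · simp [centralSeries_zero, trilogPrimitive]

end Path


theorem theorem3 (w : ℂ) (hw : ‖w‖ ≤ 1) (hre : 0 < w.re) (him : 0 ≤ w.im)
    (hconv : ‖1 - w ^ 2‖ ≤ 2 * ‖w‖) :
    HasSum
      (fun n : ℕ => (-1 : ℂ) ^ n / ((2 * (n : ℂ) + 1) ^ 3 * ((2 * n).choose n : ℂ)) *
        ((1 - w ^ 2) / w) ^ (2 * n + 1))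
      (-2 * (trilog ((1 + w) / 2) - trilog ((1 - w) / 2) - trilog ((1 + 1 / w) / 2)
          + trilog ((1 - 1 / w) / 2))
        + (dilog ((1 + w) / 2) - dilog ((1 - w) / 2) + dilog ((1 + 1 / w) / 2)
          - dilog ((1 - 1 / w) / 2)) * Complex.log w
        + (Real.pi : ℂ) * Complex.I * Complex.log ((1 + w) / 2)
          * Complex.log ((1 + 1 / w) / 2)) := by
  have hw0 : w ≠ 0 := by rintro rfl; simp at hre
  -- At `w = 1` the path degenerates (`l = 0`), but every term of the series is zero and the right
  -- side cancels.
  rcases eq_or_ne w 1 with rfl | hw1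
  · have h0 : (fun n : ℕ => (-1 : ℂ) ^ n / ((2 * (n : ℂ) + 1) ^ 3 * ((2 * n).choose n : ℂ)) *
        ((1 - (1 : ℂ) ^ 2) / 1) ^ (2 * n + 1)) = fun _ => 0 := by
      funext n; simp
    rw [h0]
    convert hasSum_zero (α := ℂ) (β := ℕ) using 1
    simp
  · have hl : Complex.log w ≠ 0 := fun h => hw1 (by rw [← Complex.exp_log hw0, h, Complex.exp_zero])
    have hlre : (Complex.log w).re ≤ 0 := by
      rw [Complex.log_re]; exact Real.log_nonpos (norm_nonneg _) hw
    have hlim : 0 ≤ (Complex.log w).im := by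
      rw [Complex.log_im]; exact Complex.arg_nonneg_iff.2 him
    have hlim' : (Complex.log w).im < Real.pi / 2 := by
      rw [Complex.log_im]
      exact (abs_lt.1 (Complex.abs_arg_lt_pi_div_two_iff.2 (Or.inl hre))).2
    have hy : -2 * Complex.sinh (Complex.log w) = (1 - w ^ 2) / w := by
      rw [neg_two_mul_sinh, Complex.exp_log hw0]
    have hyn : ‖(1 - w ^ 2) / w‖ ≤ 2 := by
      rw [norm_div, div_le_iff₀ (norm_pos_iff.2 hw0)]; exact hconv
    have hsum := hasSum_centralSeries_three hyn
    have hval := centralSeries_three_sinh hl hlre hlim hlim' (by rw [hy]; exact hyn)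
    rw [hy] at hval
    rw [hval, trilogPrimitive, Complex.ofReal_one, one_mul, Complex.exp_log hw0,
      ← log_one_add_inv_div_two hre him] at hsum
    exact hsum
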